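/- Notation. Write $\bar u=u^{-1}$, $\sigma(u)=u-\bar u$. Let $k$ be a field (for instance $\mathbb C$), let $a\in k$ with $a\ne 0$ and $a^4\neq 1$, let $m\ge 0$ be an integer, and let $x_1,\dots,x_{m+1},y_1,\dots,y_{m+1}$ be indeterminates. Put $\mathbf x=(x_1,\dots,x_{m+1})$, $\mathbf x'=(x_1,\dots,x_m)$, and likewise $\mathbf y,\mathbf y'$. A state of square ice on a graph is an orientation of its edges, with the prescribed boundary orientations, such that at each tetravalent vertex two edges enter and two leave. At the crossing of a horizontal line with parameter $x$ and a vertical line with parameter $y$ the weight is: $\sigma(a^2)$ if both horizontal edges point in and both vertical ones point out, or conversely; $\sigma(a x\bar y)$ if the arrows go straight through, right and up or left and down; $\sigma(a\bar x y)$ if they go straight through, left and up or right and down. The weight of a state is the product of the weights of its vertices, and a partition function is the sum of the weights of all states. * $Z(n;\mathbf x,\mathbf y)$: the graph is the $n\times n$ grid, with row parameters $x_1,\dots,x_n$ (from top to bottom) and column parameters $y_1,\dots,y_n$ (from left to right); horizontal boundary edges point into the grid, vertical ones out of it. * $Z_{\rm HT}(2m;\mathbf x,\mathbf y)$: the graph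 is a grid with $2m$ rows, with parameters $x_1,\dots,x_m,x_m,\dots,x_1$, and $m$ columns, with parameters $y_1,\dots,y_m$. Left boundary edges point in, upper and lower ones point out, and the right ends of the rows $r$ and $2m+1-r$ are joined by an arc forming a single edge, for $r=1,\dots,m$. * $Z_{\rm HT}(2m+1;\mathbf x,\mathbf y)$: the graph has $2m+1$ rows, with parameters $x_1,\dots,x_m,x_{m+1},x_m,\dots,x_1$. Every row crosses $m$ columns with parameters $y_1,\dots,y_m$. The middle row, after crossing these columns, turns down and, with its parameter changed from $x_{m+1}$ to $y_{m+1}$ and its direction preserved, crosses the last $m$ rows to the right of the other columns. The right ends of the rows $r$ and $2m+2-r$ are joined by an arc forming a single edge, for $r=1,\dots,m$. Left boundary edges point in, all upper and lower ones point out. * $Z^{(2)}_{\rm HT}(2m;\mathbf x,\mathbf y)$ is Kuperberg's second factor, defined by $Z_{\rm HT}(2m;\mathbf x,\mathbf y)=Z(m;\mathbf x,\mathbf y)\,Z^{(2)}_{\rm HT}(2m;\mathbf x,\mathbf y)$. **Theorem.** In the field of rational functions $k(\mathbf x,\mathbf y)$ the elements $Z(m;\mathbf x',\mathbf y')$ and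 $Z(m+1;\mathbf x,\mathbf y)$ are nonzero (so that the second factors $Z^{(2)}_{\rm HT}(2m;\mathbf x',\mathbf y')$ and $Z^{(2)}_{\rm HT}(2m+2;\mathbf x,\mathbf y)$ are well defined), and $$Z_{\rm HT}(2m+1;\mathbf x,\mathbf y)=\frac{a\,x_{m+1}y_{m+1}}{\sigma(a)(a x_{m+1}+y_{m+1})(a y_{m+1}+x_{m+1})}\Bigl[Z(m+1;\mathbf x,\mathbf y)\,Z^{(2)}_{\rm HT}(2m;\mathbf x',\mathbf y')+Z(m;\mathbf x',\mathbf y')\,Z^{(2)}_{\rm HT}(2m+2;\mathbf x,\mathbf y)\Bigr].$$ -/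

import Mathlib

/-! ### Square ice: local data

Edges carry orientations encoded by `Bool`: for a horizontal edge `true` means "directed to the
right", for a vertical edge `true` means "directed upwards".  Rows are numbered from top to bottom,
columns from left to right, starting with `0`. -/

namespace SquareIce

/-- The ice rule at a tetravalent vertex: exactly two of the four edges `l` (left), `r` (right),
`d` (below), `t` (above) enter the vertex. -/
def IceRule (l r d t : Bool) : Prop :=
  l.toNat + (!r).toNat + d.toNat + (!t).toNat = 2

instance (l r d t : Bool) : Decidable (IceRule l r d t) :=
  inferInstanceAs (Decidable (_ = _))

variable {F : Type*} [Field F]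

/-- `σ(u) = u - u⁻¹`. -/
def sigma (u : F) : F := u - u⁻¹

/-- Weight of a vertex with spectral parameter `u`: `σ(a²)` if the arrows are reversed when passing
through the vertex (entries `1` and `-1` of the alternating-sign matrix); `σ(a u)` if the arrows pass
straight through as (right, up) or (left, down); `σ(a u⁻¹)` if they pass straight through as
(left, up) or (right, down).  Orientations violating the ice rule are not states and are given
weight `0`. -/
def vertexWeight (a u : F) (l r d t : Bool) : F :=
  if IceRule l r d t then
    if l ≠ r then sigma (a ^ 2)
    else if l = d then sigma (a * u)
    else sigma (a * u⁻¹)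
  else 0

/-! ### Domain wall boundary -/

/-- Domain wall boundary conditions on an `n × n` grid: horizontal boundary edges point inwards,
vertical ones outwards.  `h i c` is the edge of row `i` to the left of column `c` (`c = n`: the
right boundary edge), `v r j` is the edge of column `j` above row `r` (`r = n`: the lower boundary
edge). -/
def IsDomainWall (n : ℕ) (h : Fin n → Fin (n + 1) → Bool) (v : Fin (n + 1) → Fin n → Bool) : Prop :=
  (∀ i, h i 0 = true ∧ h i (Fin.last n) = false) ∧
  (∀ j, v 0 j = true ∧ v (Fin.last n) j = false)

instance (n : ℕ) (h : Fin n → Fin (n + 1) → Bool) (v : Fin (n + 1) → Fin n → Bool) :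
    Decidable (IsDomainWall n h v) :=
  inferInstanceAs (Decidable (_ ∧ _))

/-- The partition function `Z(n; x, y)` of square ice with a domain wall boundary. -/
def partitionDW (n : ℕ) (a : F) (x y : Fin n → F) : F :=
  ∑ h : Fin n → Fin (n + 1) → Bool, ∑ v : Fin (n + 1) → Fin n → Bool,
    if IsDomainWall n h v then
      ∏ i : Fin n, ∏ j : Fin n,
        vertexWeight a (x i * (y j)⁻¹) (h i j.castSucc) (h i j.succ) (v i.succ j) (v i.castSucc j)
    else 0

/-! ### Half-turn symmetric boundary, even size `2m`

The graph has `2m` rows and `m` columns; the right ends of the rows `r` and `2m - 1 - r` are joined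
by an arc, and both these rows belong to one line with one spectral parameter. -/

/-- Number of the spectral parameter of row `r`: the rows carry `x₁, …, xₘ, xₘ, …, x₁`. -/
def rowEven (m : ℕ) (r : Fin (2 * m)) : Fin m :=
  ⟨min r.val (2 * m - 1 - r.val), by omega⟩

/-- Boundary conditions of even size: all left edges enter, the upper and lower edges leave, and the
orientation is preserved along the arcs (`h r m` is the edge leaving the last vertex of row `r`
to the right). -/
def IsHalfTurnEven (m : ℕ) (h : Fin (2 * m) → Fin (m + 1) → Bool)
    (v : Fin (2 * m + 1) → Fin m → Bool) : Prop :=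
  (∀ r, h r 0 = true) ∧
  (∀ r, h r.rev (Fin.last m) = !h r (Fin.last m)) ∧
  (∀ j, v 0 j = true ∧ v (Fin.last (2 * m)) j = false)

instance (m : ℕ) (h : Fin (2 * m) → Fin (m + 1) → Bool) (v : Fin (2 * m + 1) → Fin m → Bool) :
    Decidable (IsHalfTurnEven m h v) :=
  inferInstanceAs (Decidable (_ ∧ _))

/-- The partition function `Z_HT(2m; x, y)`. -/
def partitionHTEven (m : ℕ) (a : F) (x y : Fin m → F) : F :=
  ∑ h : Fin (2 * m) → Fin (m + 1) → Bool, ∑ v : Fin (2 * m + 1) → Fin m → Bool,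
    if IsHalfTurnEven m h v then
      ∏ r : Fin (2 * m), ∏ j : Fin m,
        vertexWeight a (x (rowEven m r) * (y j)⁻¹)
          (h r j.castSucc) (h r j.succ) (v r.succ j) (v r.castSucc j)
    else 0

/-- The second factor `Z_HT^{(2)}(2m; x, y)` in
`Z_HT(2m; x, y) = Z(m; x, y) * Z_HT^{(2)}(2m; x, y)`.  This is to be read in a field of rational
functions in the spectral parameters. -/
def secondFactorHT (m : ℕ) (a : F) (x y : Fin m → F) : F :=
  partitionHTEven m a x y / partitionDW m a x y

/-! ### Half-turn symmetric boundary, odd size `2m + 1`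

The graph has `2m + 1` rows.  All of them meet the columns `0, …, m - 1`; the rows `m + 1, …, 2m`
(the lower ones) moreover meet the column `m` (the half-column with the parameter `y_{m+1}`).
* The upper row `m - 1 - k` and the lower row `m + 1 + k` are joined by an arc at the right.
* The middle row `m` turns down after the column `m - 1` and becomes the column `m`; its spectral
  parameter changes from `x_{m+1}` to `y_{m+1}` at the turning point. -/

/-- Number of the spectral parameter of row `r`:
the rows carry `x₁, …, xₘ, xₘ₊₁, xₘ, …, x₁`. -/
def rowOdd (m : ℕ) (r : Fin (2 * m + 1)) : Fin (m + 1) :=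
  ⟨min r.val (2 * m - r.val), by omega⟩

/-- The middle row. -/
def midRow (m : ℕ) : Fin (2 * m + 1) := ⟨m, by omega⟩

/-- The `k`-th row below the middle one. -/
def lowRow (m : ℕ) (k : Fin m) : Fin (2 * m + 1) := ⟨m + 1 + k.val, by omega⟩

/-- Boundary conditions of odd size.  Here `h r c`, `c ≤ m`, is the edge of row `r` to the left of
column `c` (for an upper row `h r m` is the arc, for the middle row `h m m` is the turning edge),
`v r j` is the edge of the column `j < m` above row `r`, and `w k` is the edge of the column `m`
above the row `m + 1 + k` (`w m` is its lower boundary edge).  All left edges enter, all upper and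
lower edges leave, and the turning edge keeps its direction: directed to the right
before the turning point means directed downwards after it. -/
def IsHalfTurnOdd (m : ℕ) (h : Fin (2 * m + 1) → Fin (m + 1) → Bool)
    (v : Fin (2 * m + 2) → Fin m → Bool) (w : Fin (m + 1) → Bool) : Prop :=
  (∀ r, h r 0 = true) ∧
  (∀ j, v 0 j = true ∧ v (Fin.last (2 * m + 1)) j = false) ∧
  w 0 = (!h (midRow m) (Fin.last m)) ∧ w (Fin.last m) = false

instance (m : ℕ) (h : Fin (2 * m + 1) → Fin (m + 1) → Bool)
    (v : Fin (2 * m + 2) → Fin m → Bool) (w : Fin (m + 1) → Bool) :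
    Decidable (IsHalfTurnOdd m h v w) :=
  inferInstanceAs (Decidable (_ ∧ _))

/-- The partition function `Z_HT(2m+1; x, y)`.  The second product is over the vertices of the
half-column `m`; the right edge of such a vertex in the row `m + 1 + k` is the arc coming from the
upper row `m - 1 - k`, so it is directed to the right if and only if the arc leaves
that upper row in the opposite direction. -/
def partitionHTOdd (m : ℕ) (a : F) (x y : Fin (m + 1) → F) : F :=
  ∑ h : Fin (2 * m + 1) → Fin (m + 1) → Bool, ∑ v : Fin (2 * m + 2) → Fin m → Bool,
    ∑ w : Fin (m + 1) → Bool,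
      if IsHalfTurnOdd m h v w then
        (∏ r : Fin (2 * m + 1), ∏ j : Fin m,
          vertexWeight a (x (rowOdd m r) * (y j.castSucc)⁻¹)
            (h r j.castSucc) (h r j.succ) (v r.succ j) (v r.castSucc j)) *
        ∏ k : Fin m,
          vertexWeight a (x (rowOdd m (lowRow m k)) * (y (Fin.last m))⁻¹)
            (h (lowRow m k) (Fin.last m)) (!h (lowRow m k).rev (Fin.last m))
            (w k.succ) (w k.castSucc)
      else 0

/-! ### The field of rational functions in the spectral parameters -/

/-- The field `k(x₁, …, xₙ, y₁, …, yₙ)`. -/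
abbrev SpectralField (k : Type*) [Field k] (n : ℕ) : Type _ :=
  FractionRing (MvPolynomial (Fin n ⊕ Fin n) k)

/-- The indeterminates `xᵢ`. -/
noncomputable def xVar (k : Type*) [Field k] (n : ℕ) (i : Fin n) : SpectralField k n :=
  algebraMap (MvPolynomial (Fin n ⊕ Fin n) k) _ (MvPolynomial.X (Sum.inl i))

/-- The indeterminates `yᵢ`. -/
noncomputable def yVar (k : Type*) [Field k] (n : ℕ) (i : Fin n) : SpectralField k n :=
  algebraMap (MvPolynomial (Fin n ⊕ Fin n) k) _ (MvPolynomial.X (Sum.inr i))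

end SquareIce

open SquareIce

/-! Rows act as transfer matrices on the states of the columns. A half-turn symmetric boundary then
becomes a system of nested arcs (`nestOp`); in odd size the arcs are crossed by the half-column with
parameter w = y_{m+1}, which starts where the row with parameter u = x_{m+1} turns down
(`crossedOp`).

In the odd partition function both states of the turning point have weight 1. Put z = u/w and give
the two states the weights σ(az) + σ(a/z) and σ(a²) instead, in one order or the other
(`turnWeight`). For both orders the partition function factors (`wallEntry_crossedOp`): one order
yields Z(m+1)·D(m), the other Z(m)·D(m+1), where D is the determinant `factorDet`. On either state
the two weights add up to σ(a)(a + a⁻¹ + z + z⁻¹), so the sum of the two products is this constant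
times Z_HT(2m+1) (`wallEntry_crossedOp_rowOp`). The constant equals σ(a)(au + w)(aw + u)/(auw), the
inverse of the prefactor in the theorem.

D is Kuperberg's second factor (`wallEntry_nestOp_one`): the determinant of 1/σ(ax_i/y_j) +
1/σ(ay_j/x_i), with denominators cleared row by row, divided by two Vandermonde products.

The factorizations are proved by induction on the size, interpolating in the parameter t of the
outermost line. Both sides are symmetric in the column parameters and are Laurent polynomials in t
of fixed parity. At t = a^{±1}y_j a corner freezes, and both sides reduce to the smaller size with
the same factor. For n columns these 2n points suffice when there is no half-column. The half-column
raises the degree by one, and the missing point is t = aw: there the vertex of the outermost arc on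
the half-column splits, the Yang–Baxter equation carries the lower row of that arc inwards to the
row u, and nested arcs remain whose innermost one changes its parameter from u to aw. Their
factorization (`wallEntry_nestOp_arcOp`) follows from the corners alone.

Interpolation takes place at elements of a field subject to the condition `Generic`, which the
indeterminates satisfy. The domain wall partition function is nonzero because a single state
survives at x_i = a⁻¹y_i. -/

namespace SquareIce

/-! ### Transfer matrices of lines -/

section PathSum

variable {R ι : Type*} [CommSemiring R] [Fintype ι] [DecidableEq ι]

/-- An entry of a product of matrices is a sum over paths. -/
theorem ofFn_prod_apply {n : ℕ} (M : Fin n → Matrix ι ι R) (s e : ι) :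
    (List.ofFn M).prod s e =
      ∑ p : Fin (n + 1) → ι, if p 0 = s ∧ p (Fin.last n) = e then
        ∏ i : Fin n, M i (p i.castSucc) (p i.succ) else 0 := by
  induction n generalizing s with
  | zero =>
    rw [← (Equiv.funUnique (Fin 1) ι).symm.sum_comp]
    by_cases h : s = e
    · subst h
      simp [Equiv.funUnique]
    · have : ∀ x : ι, ¬ (x = s ∧ x = e) := by rintro x ⟨rfl, h'⟩; exact h h'
      simp [h, Equiv.funUnique, this]
  | succ n ih =>
    rw [List.ofFn_succ, List.prod_cons, Matrix.mul_apply, ← (Fin.consEquiv fun _ => ι).sum_comp,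
      Fintype.sum_prod_type]
    symm
    rw [Finset.sum_eq_single s]
    · have : ∀ q : Fin (n + 1) → ι, (if (Fin.cons s q : Fin (n + 2) → ι) 0 = s ∧
          (Fin.cons s q : Fin (n + 2) → ι) (Fin.last (n + 1)) = e then
          ∏ i : Fin (n + 1), M i ((Fin.cons s q : Fin (n + 2) → ι) i.castSucc)
            ((Fin.cons s q : Fin (n + 2) → ι) i.succ) else 0)
          = ∑ j, M 0 s j * if q 0 = j ∧ q (Fin.last n) = e then
            ∏ i : Fin n, M i.succ (q i.castSucc) (q i.succ) else 0 := by
        intro q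
        rw [Finset.sum_eq_single (q 0)]
        · simp only [← Fin.succ_last, Fin.cons_succ, Fin.cons_zero, true_and, Fin.prod_univ_succ,
            Fin.castSucc_zero, ← Fin.succ_castSucc, mul_ite, mul_zero]
        · intro b _ hb
          rw [if_neg, mul_zero]
          rintro ⟨h, -⟩
          exact hb h.symm
        · simp
      simp only [Fin.consEquiv, Equiv.coe_fn_mk]
      refine (Finset.sum_congr rfl fun q _ => this q).trans ?_
      rw [Finset.sum_comm]
      refine Finset.sum_congr rfl fun j _ => ?_
      rw [ih, Finset.mul_sum]
    · intro b _ hb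
      refine Finset.sum_eq_zero fun q _ => if_neg ?_
      simp [Fin.consEquiv, hb]
    · simp

end PathSum

variable {F : Type*} [Field F]

/-- The transfer matrix of a line with incoming state `l` and outgoing state `r` crossing `n`
transversal lines, with the parameter `u j` at the `j`-th crossing. -/
def lineOp (a : F) {n : ℕ} (u : Fin n → F) (l r : Bool) : Matrix (Fin n → Bool) (Fin n → Bool) F :=
  .of fun t d => (List.ofFn fun j => (.of fun p q => vertexWeight a (u j) p q (d j) (t j) :
    Matrix Bool Bool F)).prod l r

theorem lineOp_zero (a : F) (u : Fin 0 → F) (l r : Bool) (t d : Fin 0 → Bool) :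
    lineOp a u l r t d = if l = r then 1 else 0 := by
  simp [lineOp, Matrix.one_apply]

theorem lineOp_cons (a : F) {n : ℕ} (u₀ : F) (u : Fin n → F) (l r t₀ d₀ : Bool)
    (t d : Fin n → Bool) :
    lineOp a (Fin.cons u₀ u : Fin (n + 1) → F) l r (Fin.cons t₀ t : Fin (n + 1) → Bool)
      (Fin.cons d₀ d : Fin (n + 1) → Bool) =
      ∑ m, vertexWeight a u₀ l m d₀ t₀ * lineOp a u m r t d := by
  simp [lineOp, List.ofFn_succ, Matrix.mul_apply]

theorem lineOp_succ (a : F) {n : ℕ} (u : Fin (n + 1) → F) (l r : Bool)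
    (t d : Fin (n + 1) → Bool) :
    lineOp a u l r t d =
      ∑ m, vertexWeight a (u 0) l m (d 0) (t 0) *
        lineOp a (Fin.tail u) m r (Fin.tail t) (Fin.tail d) := by
  rw [← lineOp_cons]; simp only [Fin.cons_self_tail]

/-! ### Yang–Baxter equation and exchange of parallel lines -/

theorem vertexWeight_transpose (a u : F) (l r d t : Bool) :
    vertexWeight a u l r d t = vertexWeight a u t d r l := by
  revert l r d t
  simp only [Bool.forall_bool, vertexWeight, IceRule]
  simp

/-- The parameter of the auxiliary crossing is forced to be p = a u / u'. The relation is then a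
finite check over the states of the six outer edges. -/
theorem vertexWeight_yang_baxter {a p u u' : F} (ha : a ≠ 0) (hp : p ≠ 0) (hu : u ≠ 0)
    (h : a * u = p * u') (l l' r r' t d : Bool) :
    ∑ s, ∑ s', ∑ m, vertexWeight a p s r' s' r *
      (vertexWeight a u l s m t * vertexWeight a u' l' s' d m) =
    ∑ s, ∑ s', ∑ m, vertexWeight a p l s' l' s *
      (vertexWeight a u' s r m t * vertexWeight a u s' r' d m) := by
  obtain rfl : u' = a * u / p := by field_simp; linear_combination -h
  revert l l' r r' t d
  simp only [Bool.forall_bool, Fintype.sum_bool, vertexWeight, IceRule, sigma]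
  simp
  field_simp
  simp
  repeat' apply And.intro
  all_goals ring

theorem lineOp_mul_lineOp_succ (a : F) {n : ℕ} (u u' : Fin (n + 1) → F) (l r l' r' : Bool)
    (t d : Fin (n + 1) → Bool) :
    (lineOp a u l r * lineOp a u' l' r') t d = ∑ k, ∑ k',
      (∑ m, vertexWeight a (u 0) l k m (t 0) * vertexWeight a (u' 0) l' k' (d 0) m) *
        (lineOp a (Fin.tail u) k r * lineOp a (Fin.tail u') k' r') (Fin.tail t) (Fin.tail d) := by
  have e : (lineOp a u l r * lineOp a u' l' r') t d = ∑ m, ∑ g : Fin n → Bool,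
      (∑ k, vertexWeight a (u 0) l k m (t 0) * lineOp a (Fin.tail u) k r (Fin.tail t) g) *
      ∑ k', vertexWeight a (u' 0) l' k' (d 0) m * lineOp a (Fin.tail u') k' r' g (Fin.tail d) := by
    rw [Matrix.mul_apply, ← (Fin.consEquiv fun _ => Bool).sum_comp, Fintype.sum_prod_type]
    refine Finset.sum_congr rfl fun m _ => Finset.sum_congr rfl fun g _ => ?_
    rw [lineOp_succ, lineOp_succ]
    rfl
  rw [e]
  simp only [Matrix.mul_apply, Fintype.sum_bool, ← Finset.sum_add_distrib, Finset.mul_sum]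
  exact Finset.sum_congr rfl fun g _ => by ring

/-- Two parallel lines are exchanged by a crossing moved from one end to the other. -/
theorem lineOp_exchange {a p : F} (ha : a ≠ 0) (hp : p ≠ 0) {n : ℕ} (u u' : Fin n → F)
    (hu : ∀ j, u j ≠ 0) (h : ∀ j, a * u j = p * u' j) (l l' r r' : Bool) :
    ∑ s, ∑ s', vertexWeight a p s r' s' r • (lineOp a u l s * lineOp a u' l' s') =
    ∑ s, ∑ s', vertexWeight a p l s' l' s • (lineOp a u' s r * lineOp a u s' r') := by
  induction n generalizing l l' with
  | zero =>
    ext t d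
    simp only [Fintype.sum_bool, Matrix.add_apply, Matrix.smul_apply, Matrix.mul_apply,
      Fintype.sum_unique, lineOp_zero, smul_eq_mul]
    cases l <;> cases l' <;> cases r <;> cases r' <;> simp
  | succ n ih =>
    ext t d
    have key := fun k k' => congrFun (congrFun (ih (Fin.tail u) (Fin.tail u') (fun j => hu _)
      (fun j => h _) k k') (Fin.tail t)) (Fin.tail d)
    have yb := fun s s' => vertexWeight_yang_baxter ha hp (hu 0) (h 0) l l' s s' (t 0) (d 0)
    simp only [Fintype.sum_bool, Matrix.add_apply, Matrix.smul_apply, smul_eq_mul,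
      lineOp_mul_lineOp_succ] at key yb ⊢
    obtain ⟨A, hA⟩ : ∃ A : Bool → Bool → Bool → Bool → F, ∀ k s k' s',
      (lineOp a (Fin.tail u) k s * lineOp a (Fin.tail u') k' s') (Fin.tail t) (Fin.tail d) =
        A k s k' s' := ⟨_, fun _ _ _ _ => rfl⟩
    obtain ⟨B, hB⟩ : ∃ B : Bool → Bool → Bool → Bool → F, ∀ k s k' s',
      (lineOp a (Fin.tail u') k s * lineOp a (Fin.tail u) k' s') (Fin.tail t) (Fin.tail d) =
        B k s k' s' := ⟨_, fun _ _ _ _ => rfl⟩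
    obtain ⟨c, hc⟩ : ∃ c : Bool → Bool → F, ∀ k k', vertexWeight a (u 0) l k true (t 0) *
      vertexWeight a (u' 0) l' k' (d 0) true + vertexWeight a (u 0) l k false (t 0) *
      vertexWeight a (u' 0) l' k' (d 0) false = c k k' := ⟨_, fun _ _ => rfl⟩
    simp only [hA, hB, hc] at key ⊢
    simp only [← mul_add, hc] at yb
    -- The crossing passes the remaining transversal lines by `key`, weighted with the first column
    -- of vertices `c`, and then the first line by `yb`, weighted with the remainder `B`.
    linear_combination c true true * key true true + c true false * key true false +
      c false true * key false true + c false false * key false false +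
      B true r true r' * yb true true + B true r false r' * yb true false +
      B false r true r' * yb false true + B false r false r' * yb false false

/-! ### Grid partition functions and their symmetry in the parameters -/

/-- The partition function of a grid with the boundary states `l`, `r`, `t`, `d` on the left, right,
top and bottom, and arbitrary spectral parameters of the vertices. -/
def gridSum {N n : ℕ} (a : F) (U : Fin N → Fin n → F) (l r : Fin N → Bool) (t d : Fin n → Bool) : F :=
  ∑ h : Fin N → Fin (n + 1) → Bool, ∑ v : Fin (N + 1) → Fin n → Bool,
    if (∀ i, h i 0 = l i ∧ h i (Fin.last n) = r i) ∧ ∀ j, v 0 j = t j ∧ v (Fin.last N) j = d j then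
      ∏ i : Fin N, ∏ j : Fin n,
        vertexWeight a (U i j) (h i j.castSucc) (h i j.succ) (v i.succ j) (v i.castSucc j)
    else 0

/-- For fixed vertical edges the rows are independent, so the horizontal edges are summed row by
row; the remaining sum over vertical edges is a sum over paths for a matrix product. -/
theorem gridSum_eq_rows {N n : ℕ} (a : F) (U : Fin N → Fin n → F) (l r : Fin N → Bool)
    (t d : Fin n → Bool) :
    gridSum a U l r t d = (List.ofFn fun i => lineOp a (U i) (l i) (r i)).prod t d := by
  rw [ofFn_prod_apply, gridSum, Finset.sum_comm]
  refine Finset.sum_congr rfl fun v _ => ?_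
  by_cases hv : v 0 = t ∧ v (Fin.last N) = d
  · have hv' : ∀ j, v 0 j = t j ∧ v (Fin.last N) j = d j := fun j => by simp [hv.1, hv.2]
    simp only [hv, hv', lineOp, Matrix.of_apply, ofFn_prod_apply, and_self, if_true,
      Finset.prod_univ_sum, Fintype.piFinset_univ, Finset.prod_ite_zero]
    simp
  · have hv' : ¬ ∀ j, v 0 j = t j ∧ v (Fin.last N) j = d j := fun h =>
      hv ⟨funext fun j => (h j).1, funext fun j => (h j).2⟩
    simp [hv, hv']

/-- The vertex weight is unchanged when left is exchanged with top and right with bottom. Statements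
on rows therefore carry over to columns. -/
theorem gridSum_transpose {N n : ℕ} (a : F) (U : Fin N → Fin n → F) (l r : Fin N → Bool)
    (t d : Fin n → Bool) :
    gridSum a U l r t d = gridSum a (fun j i => U i j) t d l r := by
  rw [gridSum, Finset.sum_comm, gridSum, ← (Equiv.piComm fun _ _ => Bool).sum_comp]
  refine Finset.sum_congr rfl fun v _ => ?_
  rw [← (Equiv.piComm fun _ _ => Bool).sum_comp]
  refine Finset.sum_congr rfl fun h _ => ?_
  rw [Finset.prod_comm]
  simp only [Equiv.piComm_apply, Function.swap, vertexWeight_transpose a _ (h _ _), and_comm]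

theorem gridSum_eq_cols {N n : ℕ} (a : F) (U : Fin N → Fin n → F) (l r : Fin N → Bool)
    (t d : Fin n → Bool) :
    gridSum a U l r t d = (List.ofFn fun j => lineOp a (fun i => U i j) (t j) (d j)).prod l r := by
  rw [gridSum_transpose, gridSum_eq_rows]

/-- Transfer matrices of lines going from `true` to `false` commute. -/
theorem lineOp_commute {a p : F} (ha : a ≠ 0) (hp : p ≠ 0) (hσ : sigma (a * p) ≠ 0) {n : ℕ}
    (u u' : Fin n → F) (hu : ∀ j, u j ≠ 0) (h : ∀ j, a * u j = p * u' j) :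
    Commute (lineOp a u true false) (lineOp a u' true false) := by
  -- At either end the ice rule leaves one state of the crossing, in which both lines run straight
  -- with weight σ(a p); these equal factors cancel.
  have key := lineOp_exchange ha hp u u' hu h true true false false
  have h1 : vertexWeight a p true true true true = sigma (a * p) := by simp [vertexWeight, IceRule]
  have h2 : vertexWeight a p false false false false = sigma (a * p) := by
    simp [vertexWeight, IceRule]
  have h3 : vertexWeight a p true false true false = 0 := by simp [vertexWeight, IceRule]
  have h4 : vertexWeight a p true false false false = 0 := by simp [vertexWeight, IceRule]
  have h5 : vertexWeight a p false false true false = 0 := by simp [vertexWeight, IceRule]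
  have h6 : vertexWeight a p true true true false = 0 := by simp [vertexWeight, IceRule]
  have h7 : vertexWeight a p true false true true = 0 := by simp [vertexWeight, IceRule]
  simp only [Fintype.sum_bool, h1, h2, h3, h4, h5, h6, h7, zero_smul, add_zero, zero_add] at key
  exact smul_right_injective _ hσ key

/-- Every column goes from `true` to `false`, so the column transfer matrices commute pairwise and
their product does not depend on the order. The left and right boundaries are arbitrary, which is
what nested arcs require. -/
theorem gridSum_perm {N n : ℕ} {a : F} (ha : a ≠ 0) (x : Fin N → F) (y : Fin n → F)
    (hx : ∀ i, x i ≠ 0) (hy : ∀ j, y j ≠ 0)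
    (hσ : ∀ i j, i ≠ j → sigma (a * (a * y i * (y j)⁻¹)) ≠ 0)
    (l r : Fin N → Bool) (π : Equiv.Perm (Fin n)) :
    gridSum a (fun i j => x i * (y (π j))⁻¹) l r (fun _ => true) (fun _ => false) =
      gridSum a (fun i j => x i * (y j)⁻¹) l r (fun _ => true) (fun _ => false) := by
  rw [gridSum_eq_cols, gridSum_eq_cols]
  let C : Fin n → Matrix (Fin N → Bool) (Fin N → Bool) F :=
    fun j => lineOp a (fun i => x i * (y j)⁻¹) true false
  suffices h : (List.ofFn (C ∘ π)).prod = (List.ofFn C).prod from congrFun (congrFun h l) r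
  refine List.Perm.prod_eq' (Equiv.Perm.ofFn_comp_perm π C) ?_
  rw [List.pairwise_ofFn]
  intro i j hij
  have hi := hy (π i)
  have hj := hy (π j)
  refine lineOp_commute ha (p := a * y (π j) * (y (π i))⁻¹) (by simp [ha, hi, hj])
    (hσ _ _ fun h => hij.ne' (π.injective h)) _ _ (fun k => ?_) fun k => ?_
  · exact mul_ne_zero (hx k) (inv_ne_zero hi)
  · field_simp

/-! ### Frozen lines, frozen corners, and the blocks of the first column -/

theorem funext_cons_iff {n : ℕ} (t : Fin (n + 1) → Bool) (c : Bool) (s : Fin n → Bool) :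
    t = Fin.cons c s ↔ t 0 = c ∧ Fin.tail t = s := by
  constructor
  · rintro rfl
    simp
  · rintro ⟨rfl, rfl⟩
    simp

theorem const_eq_cons {n : ℕ} (c : Bool) :
    (fun _ : Fin (n + 1) => c) = Fin.cons c fun _ : Fin n => c := by
  ext j
  refine Fin.cases ?_ (fun i => ?_) j <;> simp

/-- Two outgoing edges, to the left and above, force the other two edges of the vertex to enter; the
same situation then recurs at the next vertex. -/
theorem lineOp_false_top (a : F) {n : ℕ} (u : Fin n → F) (r : Bool) (d : Fin n → Bool) :
    lineOp a u false r (fun _ => true) d =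
      if r = false ∧ d = fun _ => true then ∏ j, sigma (a * (u j)⁻¹) else 0 := by
  induction n with
  | zero => rw [lineOp_zero]; simp [eq_comm, Subsingleton.elim d fun _ => true]
  | succ n ih =>
    rw [lineOp_succ, Fintype.sum_bool, const_eq_cons]
    have := ih (Fin.tail u) (Fin.tail d)
    simp only [Fin.tail_cons, funext_cons_iff, this, Fin.prod_univ_succ]
    cases d 0 <;> simp [vertexWeight, IceRule, Fin.tail]

/-- If the row turned anywhere, `lineOp_false_top` would keep it directed to the left until its
right end. -/
theorem lineOp_true_top (a : F) {n : ℕ} (u : Fin n → F) (d : Fin n → Bool) :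
    lineOp a u true true (fun _ => true) d =
      if d = fun _ => true then ∏ j, sigma (a * u j) else 0 := by
  induction n with
  | zero => rw [lineOp_zero]; simp [Subsingleton.elim d fun _ => true]
  | succ n ih =>
    rw [lineOp_succ, Fintype.sum_bool, const_eq_cons]
    have := ih (Fin.tail u) (Fin.tail d)
    simp only [Fin.tail_cons, funext_cons_iff, this, Fin.prod_univ_succ, lineOp_false_top]
    cases d 0 <;> simp [vertexWeight, IceRule, Fin.tail]

theorem lineOp_false_bottom (a : F) {n : ℕ} (u : Fin n → F) (r : Bool) (t : Fin n → Bool) :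
    lineOp a u false r t (fun _ => false) =
      if r = false ∧ t = fun _ => false then ∏ j, sigma (a * u j) else 0 := by
  induction n with
  | zero => rw [lineOp_zero]; simp [eq_comm, Subsingleton.elim t fun _ => false]
  | succ n ih =>
    rw [lineOp_succ, Fintype.sum_bool, const_eq_cons]
    have := ih (Fin.tail u) (Fin.tail t)
    simp only [Fin.tail_cons, funext_cons_iff, this, Fin.prod_univ_succ]
    cases t 0 <;> simp [vertexWeight, IceRule, Fin.tail]

theorem lineOp_true_bottom (a : F) {n : ℕ} (u : Fin n → F) (t : Fin n → Bool) :
    lineOp a u true true t (fun _ => false) =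
      if t = fun _ => false then ∏ j, sigma (a * (u j)⁻¹) else 0 := by
  induction n with
  | zero => rw [lineOp_zero]; simp [Subsingleton.elim t fun _ => false]
  | succ n ih =>
    rw [lineOp_succ, Fintype.sum_bool, const_eq_cons]
    have := ih (Fin.tail u) (Fin.tail t)
    simp only [Fin.tail_cons, funext_cons_iff, this, Fin.prod_univ_succ, lineOp_false_bottom]
    cases t 0 <;> simp [vertexWeight, IceRule, Fin.tail]

theorem lineOp_true_top_mul (a : F) {n : ℕ} (u : Fin n → F)
    (X : Matrix (Fin n → Bool) (Fin n → Bool) F) (d : Fin n → Bool) :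
    (lineOp a u true true * X) (fun _ => true) d =
      (∏ j, sigma (a * u j)) * X (fun _ => true) d := by
  simp [Matrix.mul_apply, lineOp_true_top]

theorem mul_lineOp_true_bottom (a : F) {n : ℕ} (u : Fin n → F)
    (X : Matrix (Fin n → Bool) (Fin n → Bool) F) (t : Fin n → Bool) :
    (X * lineOp a u true true) t (fun _ => false) =
      (∏ j, sigma (a * (u j)⁻¹)) * X t (fun _ => false) := by
  simp [Matrix.mul_apply, lineOp_true_bottom, mul_comm]

/-- `q` or `q⁻¹`. -/
def signPow (c : Bool) (q : F) : F := if c then q else q⁻¹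

@[simp] theorem signPow_true (q : F) : signPow true q = q := rfl

@[simp] theorem signPow_false (q : F) : signPow false q = q⁻¹ := rfl

@[simp] theorem sigma_one : sigma (1 : F) = 0 := by simp [sigma]

/-- At u 0 = a the weight σ(a / u 0) = σ(1) of passing straight through the corner vanishes. The row
has to turn there, and the rest of it is frozen. -/
theorem lineOp_corner_bottom {a : F} (ha : a ≠ 0) {n : ℕ} (u : Fin (n + 1) → F) (hu : u 0 = a)
    (r : Bool) (t : Fin (n + 1) → Bool) :
    lineOp a u true r t (fun _ => false) =
      if r = false ∧ t = Fin.cons true fun _ => false then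
        sigma (a ^ 2) * ∏ j, sigma (a * u (Fin.succ j)) else 0 := by
  rw [lineOp_succ, Fintype.sum_bool, hu]
  have := lineOp_false_bottom a (Fin.tail u) r (Fin.tail t)
  simp only [const_eq_cons, Fin.tail_cons, funext_cons_iff, this]
  cases t 0 <;> simp [vertexWeight, IceRule, Fin.tail, ha]

theorem lineOp_corner_top {a : F} (ha : a ≠ 0) {n : ℕ} (u : Fin (n + 1) → F) (hu : u 0 = a⁻¹)
    (r : Bool) (d : Fin (n + 1) → Bool) :
    lineOp a u true r (fun _ => true) d =
      if r = false ∧ d = Fin.cons false fun _ => true then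
        sigma (a ^ 2) * ∏ j, sigma (a * (u (Fin.succ j))⁻¹) else 0 := by
  rw [lineOp_succ, Fintype.sum_bool, hu]
  have := lineOp_false_top a (Fin.tail u) r (Fin.tail d)
  simp only [const_eq_cons, Fin.tail_cons, funext_cons_iff, this]
  cases d 0 <;> simp [vertexWeight, IceRule, Fin.tail, ha]

/-- The block of an operator in which the first vertical line keeps the state `c`. -/
def firstBlock (c : Bool) {n : ℕ} (M : Matrix (Fin (n + 1) → Bool) (Fin (n + 1) → Bool) F) :
    Matrix (Fin n → Bool) (Fin n → Bool) F :=
  .of fun t d => M (Fin.cons c t) (Fin.cons c d)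

/-- The first vertical line does not change its state from `false` to `true`. -/
def IsFirstTriangular {n : ℕ} (M : Matrix (Fin (n + 1) → Bool) (Fin (n + 1) → Bool) F) : Prop :=
  ∀ t d, M (Fin.cons false t) (Fin.cons true d) = 0

theorem sum_fin_succ_bool {n : ℕ} (f : (Fin (n + 1) → Bool) → F) :
    ∑ g, f g = ∑ g : Fin n → Bool, f (Fin.cons true g) + ∑ g : Fin n → Bool, f (Fin.cons false g) := by
  rw [← (Fin.consEquiv fun _ => Bool).sum_comp, Fintype.sum_prod_type, Fintype.sum_bool]
  rfl

section FirstBlock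

variable {n : ℕ} {A B : Matrix (Fin (n + 1) → Bool) (Fin (n + 1) → Bool) F}

theorem IsFirstTriangular.mul (hA : IsFirstTriangular A) (hB : IsFirstTriangular B) :
    IsFirstTriangular (A * B) := fun t d => by
  rw [Matrix.mul_apply, sum_fin_succ_bool]
  simp [hA _ _, hB _ _]

theorem IsFirstTriangular.smul (hA : IsFirstTriangular A) (q : F) :
    IsFirstTriangular (q • A) := fun t d => by
  simp [hA _ _]

theorem isFirstTriangular_one :
    IsFirstTriangular (1 : Matrix (Fin (n + 1) → Bool) (Fin (n + 1) → Bool) F) := fun t d => by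
  rw [Matrix.one_apply, if_neg]
  intro h
  simpa using congrFun h 0

theorem IsFirstTriangular.sum {κ : Type*} (s : Finset κ)
    {f : κ → Matrix (Fin (n + 1) → Bool) (Fin (n + 1) → Bool) F}
    (hf : ∀ i, IsFirstTriangular (f i)) : IsFirstTriangular (∑ i ∈ s, f i) := fun t d => by
  simp [Matrix.sum_apply, hf _ _ _]

/-- With respect to the state of the first column the operators are block triangular, and taking a
diagonal block of such operators is multiplicative. -/
theorem firstBlock_mul (c : Bool) (hA : IsFirstTriangular A) (hB : IsFirstTriangular B) :
    firstBlock c (A * B) = firstBlock c A * firstBlock c B := by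
  ext t d
  simp only [firstBlock, Matrix.of_apply, Matrix.mul_apply]
  rw [sum_fin_succ_bool]
  cases c <;> simp [hA _ _, hB _ _]

@[simp] theorem firstBlock_smul (c : Bool) (q : F) : firstBlock c (q • A) = q • firstBlock c A := rfl

@[simp] theorem firstBlock_one (c : Bool) :
    firstBlock c (1 : Matrix (Fin (n + 1) → Bool) (Fin (n + 1) → Bool) F) = 1 := by
  ext t d
  simp [firstBlock, Matrix.one_apply]

@[simp] theorem firstBlock_sum (c : Bool) {κ : Type*} (s : Finset κ)
    (f : κ → Matrix (Fin (n + 1) → Bool) (Fin (n + 1) → Bool) F) :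
    firstBlock c (∑ i ∈ s, f i) = ∑ i ∈ s, firstBlock c (f i) := by
  ext t d
  simp [firstBlock, Matrix.sum_apply]

end FirstBlock

/-- A change of the first column from `false` above to `true` below would let three edges enter the
first vertex, since the row enters from the left. -/
theorem isFirstTriangular_lineOp (a : F) {n : ℕ} (u : Fin (n + 1) → F) (r : Bool) :
    IsFirstTriangular (lineOp a u true r) := fun t d => by
  rw [lineOp_succ]
  simp [vertexWeight, IceRule]

theorem firstBlock_lineOp (a : F) {n : ℕ} (c : Bool) (u : Fin (n + 1) → F) (r : Bool) :
    firstBlock c (lineOp a u true r) =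
      sigma (a * signPow c (u 0)) • lineOp a (Fin.tail u) true r := by
  ext t d
  rw [firstBlock, Matrix.of_apply, lineOp_succ]
  cases c <;> simp [vertexWeight, IceRule]

/-- Value of the partition function of an outermost line at the points where a corner freezes. -/
theorem corner_entry {a : F} (ha : a ≠ 0) {n : ℕ} (c : Bool) (u : Fin (n + 1) → F)
    (hu : u 0 = signPow c a) (X : Matrix (Fin (n + 1) → Bool) (Fin (n + 1) → Bool) F)
    (b s : Bool) (hbs : b = true ∨ s = true) :
    (lineOp a u true b * X * lineOp a u true s) (fun _ => true) (fun _ => false) =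
      if b = c ∧ s = !c then (sigma (a ^ 2) * ∏ j, sigma (a * signPow c (u (Fin.succ j)))) ^ 2 *
        firstBlock c X (fun _ => true) (fun _ => false) else 0 := by
  cases c
  · rw [mul_assoc, Matrix.mul_apply]
    simp only [lineOp_corner_top ha u hu, ite_mul, zero_mul]
    cases b
    · obtain rfl : s = true := by simpa using hbs
      simp only [mul_lineOp_true_bottom, true_and, Bool.not_false, and_self, if_true,
        Finset.sum_ite_eq', Finset.mem_univ, Fin.prod_univ_succ, hu, signPow_false, inv_inv,
        firstBlock, Matrix.of_apply]
      rw [← const_eq_cons false, pow_two a]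
      ring
    · simp
  · rw [Matrix.mul_apply]
    simp only [lineOp_corner_bottom ha u hu, mul_ite, mul_zero]
    cases s
    · obtain rfl : b = true := by simpa using hbs
      simp only [lineOp_true_top_mul, true_and, Bool.not_true, and_self, if_true,
        Finset.sum_ite_eq', Finset.mem_univ, Fin.prod_univ_succ, hu, signPow_true, firstBlock,
        Matrix.of_apply]
      rw [← const_eq_cons true, pow_two a]
      ring
    · simp

theorem corner_entry_top {a : F} (ha : a ≠ 0) {n : ℕ} (u : Fin (n + 1) → F) (hu : u 0 = a⁻¹)
    (X : Matrix (Fin (n + 1) → Bool) (Fin (n + 1) → Bool) F) :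
    (lineOp a u true false * X) (fun _ => true) (fun _ => false) =
      (sigma (a ^ 2) * ∏ j, sigma (a * signPow false (u (Fin.succ j)))) *
        firstBlock false X (fun _ => true) (fun _ => false) := by
  simp only [Matrix.mul_apply, lineOp_corner_top ha u hu, ite_mul, zero_mul, true_and,
    Finset.sum_ite_eq', Finset.mem_univ, if_true, firstBlock, Matrix.of_apply, const_eq_cons false,
    signPow_false]

theorem corner_entry_bottom {a : F} (ha : a ≠ 0) {n : ℕ} (u : Fin (n + 1) → F) (hu : u 0 = a)
    (X : Matrix (Fin (n + 1) → Bool) (Fin (n + 1) → Bool) F) :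
    (X * lineOp a u true false) (fun _ => true) (fun _ => false) =
      (sigma (a ^ 2) * ∏ j, sigma (a * signPow true (u (Fin.succ j)))) *
        firstBlock true X (fun _ => true) (fun _ => false) := by
  simp only [Matrix.mul_apply, lineOp_corner_bottom ha u hu, mul_ite, mul_zero, true_and,
    Finset.sum_ite_eq', Finset.mem_univ, if_true, firstBlock, Matrix.of_apply, const_eq_cons true,
    signPow_true]
  ring

/-! ### Centered Laurent polynomials of fixed parity -/

/-- On `S`, the function `f` is a Laurent polynomial with exponents `-d, -d + 2, …, d`. -/
def IsLaurent (S : Set F) (d : ℕ) (f : F → F) : Prop :=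
  ∃ p : Polynomial F, p.natDegree ≤ d ∧ ∀ t ∈ S, f t * t ^ d = p.eval (t ^ 2)

namespace IsLaurent

variable {S : Set F} {d e : ℕ} {f g : F → F}

theorem congr (hf : IsLaurent S d f) (h : ∀ t ∈ S, g t = f t) : IsLaurent S d g := by
  obtain ⟨p, hp, hfp⟩ := hf
  exact ⟨p, hp, fun t ht => by rw [h t ht, hfp t ht]⟩

theorem mono {S' : Set F} (hf : IsLaurent S d f) (h : S' ⊆ S) : IsLaurent S' d f := by
  obtain ⟨p, hp, hfp⟩ := hf
  exact ⟨p, hp, fun t ht => hfp t (h ht)⟩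

theorem of_eq (hf : IsLaurent S d f) (h : d = e) : IsLaurent S e f := h ▸ hf

theorem zero : IsLaurent S d fun _ => 0 := ⟨0, by simp, by simp⟩

theorem const (c : F) : IsLaurent S 0 fun _ => c := ⟨Polynomial.C c, by simp, by simp⟩

theorem add (hf : IsLaurent S d f) (hg : IsLaurent S d g) :
    IsLaurent S d fun t => f t + g t := by
  obtain ⟨p, hp, hfp⟩ := hf
  obtain ⟨q, hq, hgq⟩ := hg
  exact ⟨p + q, (Polynomial.natDegree_add_le _ _).trans (max_le hp hq), fun t ht => by
    simp [add_mul, hfp t ht, hgq t ht]⟩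

theorem mul (hf : IsLaurent S d f) (hg : IsLaurent S e g) :
    IsLaurent S (d + e) fun t => f t * g t := by
  obtain ⟨p, hp, hfp⟩ := hf
  obtain ⟨q, hq, hgq⟩ := hg
  refine ⟨p * q, Polynomial.natDegree_mul_le.trans (add_le_add hp hq), fun t ht => ?_⟩
  rw [Polynomial.eval_mul, ← hfp t ht, ← hgq t ht]
  ring

theorem const_mul (hf : IsLaurent S d f) (c : F) : IsLaurent S d fun t => c * f t := by
  simpa using (const c).mul hf

theorem mul_const (hf : IsLaurent S d f) (c : F) : IsLaurent S d fun t => f t * c := by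
  simpa using hf.mul (const c)

theorem add_two (hf : IsLaurent S d f) : IsLaurent S (d + 2) f := by
  obtain ⟨p, hp, hfp⟩ := hf
  refine ⟨p * Polynomial.X, Polynomial.natDegree_mul_le.trans
    (by have := Polynomial.natDegree_X_le (R := F); omega), fun t ht => ?_⟩
  rw [Polynomial.eval_mul, ← hfp t ht, Polynomial.eval_X]
  ring

theorem sum {κ : Type*} (s : Finset κ) {f : κ → F → F} (hf : ∀ i ∈ s, IsLaurent S d (f i)) :
    IsLaurent S d fun t => ∑ i ∈ s, f i t := by
  classical
  induction s using Finset.induction_on with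
  | empty => simpa using zero
  | insert i s hi ih =>
    simp only [Finset.sum_insert hi]
    exact (hf i (Finset.mem_insert_self i s)).add (ih fun j hj => hf j (Finset.mem_insert_of_mem hj))

theorem prod {κ : Type*} (s : Finset κ) {f : κ → F → F} (hf : ∀ i ∈ s, IsLaurent S d (f i)) :
    IsLaurent S (s.card * d) fun t => ∏ i ∈ s, f i t := by
  classical
  induction s using Finset.induction_on with
  | empty => simpa using const 1
  | insert i s hi ih =>
    simp only [Finset.prod_insert hi, Finset.card_insert_of_notMem hi]
    rw [add_mul, one_mul, add_comm]
    exact (hf i (Finset.mem_insert_self i s)).mul (ih fun j hj => hf j (Finset.mem_insert_of_mem hj))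

theorem sigma_mul (hS : ∀ t ∈ S, t ≠ 0) (c : F) : IsLaurent S 1 fun t => sigma (c * t) := by
  refine ⟨Polynomial.C c * Polynomial.X + Polynomial.C (-c⁻¹), Polynomial.natDegree_linear_le,
    fun t ht => ?_⟩
  have := hS t ht
  simp only [sigma, mul_inv, Polynomial.eval_add, Polynomial.eval_mul, Polynomial.eval_C,
    Polynomial.eval_X]
  field_simp
  ring

theorem sigma_mul_inv (hS : ∀ t ∈ S, t ≠ 0) (c : F) : IsLaurent S 1 fun t => sigma (c * t⁻¹) := by
  refine ⟨Polynomial.C (-c⁻¹) * Polynomial.X + Polynomial.C c, Polynomial.natDegree_linear_le,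
    fun t ht => ?_⟩
  have := hS t ht
  simp only [sigma, mul_inv, inv_inv, Polynomial.eval_add, Polynomial.eval_mul, Polynomial.eval_C,
    Polynomial.eval_X]
  field_simp
  ring

/-- A Laurent polynomial is determined by its values at sufficiently many points. -/
theorem eq_of_eq_on_points {ι : Type*} [Fintype ι] (hf : IsLaurent S d f) (hg : IsLaurent S d g)
    (P : ι → F) (hcard : d < Fintype.card ι) (hP : Function.Injective fun i => P i ^ 2)
    (hPS : ∀ i, P i ∈ S) (h : ∀ i, f (P i) = g (P i)) {t : F} (ht : t ∈ S) (ht0 : t ≠ 0) :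
    f t = g t := by
  obtain ⟨p, hp, hfp⟩ := hf
  obtain ⟨q, hq, hgq⟩ := hg
  have hpq : p = q := by
    refine Polynomial.eq_of_degrees_lt_of_eval_index_eq (s := Finset.univ) (v := fun i => P i ^ 2)
      (hP.injOn) ?_ ?_ fun i _ => ?_
    · exact (Polynomial.degree_le_of_natDegree_le hp).trans_lt (by exact_mod_cast hcard)
    · exact (Polynomial.degree_le_of_natDegree_le hq).trans_lt (by exact_mod_cast hcard)
    · rw [← hfp _ (hPS i), ← hgq _ (hPS i), h i]
  have := (hfp t ht).trans ((congrArg _ hpq).trans (hgq t ht).symm)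
  exact mul_right_cancel₀ (pow_ne_zero d ht0) this

/-- Division by linear factors at whose zeros the function vanishes. -/
theorem exists_eq_prod_mul {n : ℕ} (hS : ∀ t ∈ S, t ≠ 0) (hf : IsLaurent S (d + n) f) (x : Fin n → F)
    (hx : ∀ i, x i ∈ S) (hxx : Function.Injective fun i => x i ^ 2) (h : ∀ i, f (x i) = 0) :
    ∃ g, IsLaurent S d g ∧ ∀ t ∈ S, f t = (∏ i, sigma (t * (x i)⁻¹)) * g t := by
  obtain ⟨p, hp, hfp⟩ := hf
  have hdvd : (∏ i, (Polynomial.X - Polynomial.C (x i ^ 2))) ∣ p := by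
    refine Finset.prod_dvd_of_coprime (fun i _ j _ hij => ?_) fun i _ => ?_
    · exact Polynomial.pairwise_coprime_X_sub_C hxx hij
    · rw [Polynomial.dvd_iff_isRoot, Polynomial.IsRoot, ← hfp _ (hx i), h i, zero_mul]
  obtain ⟨q, rfl⟩ := hdvd
  have hq : q.natDegree ≤ d := by
    rcases eq_or_ne q 0 with rfl | hq0
    · simp
    · rw [Polynomial.Monic.natDegree_mul' (Polynomial.monic_prod_X_sub_C _ _) hq0,
        Polynomial.natDegree_finsetProd_X_sub_C_eq_card, Finset.card_univ, Fintype.card_fin] at hp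
      omega
  -- The scalar comes from t² - x_i² = t x_i σ(t / x_i); the powers of t recentre the quotient
  -- polynomial.
  refine ⟨fun t => (∏ i, x i) * (q.eval (t ^ 2) * (t ^ d)⁻¹), const_mul ⟨q, hq, fun t ht => ?_⟩ _,
    fun t ht => ?_⟩
  · have := hS t ht
    field_simp
  · have ht0 := hS t ht
    have e : ∀ i, sigma (t * (x i)⁻¹) = (t ^ 2 - x i ^ 2) * (t⁻¹ * (x i)⁻¹) := fun i => by
      have := hS _ (hx i)
      simp only [sigma]
      field_simp
    have hx0 : ∏ i, x i ≠ 0 := Finset.prod_ne_zero_iff.2 fun i _ => hS _ (hx i)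
    have := hfp t ht
    rw [Polynomial.eval_mul, Polynomial.eval_prod] at this
    simp only [Polynomial.eval_sub, Polynomial.eval_X, Polynomial.eval_C] at this
    simp only [e, Finset.prod_mul_distrib, Finset.prod_inv_distrib, Finset.prod_const,
      Finset.card_univ, Fintype.card_fin]
    rw [pow_add] at this
    field_simp
    linear_combination this

end IsLaurent

/-! ### Degrees of transfer matrices in the spectral parameter -/

section Line

variable {S : Set F}

theorem isLaurent_vertexWeight (hS : ∀ t ∈ S, t ≠ 0) (a y : F) (l d t : Bool) :
    IsLaurent S 1 fun q => vertexWeight a (q * y⁻¹) l l d t := by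
  unfold vertexWeight
  split_ifs with h h' h''
  · exact absurd rfl h'
  · exact (IsLaurent.sigma_mul hS (a * y⁻¹)).congr fun q _ => by ring_nf
  · exact (IsLaurent.sigma_mul_inv hS (a * y)).congr fun q _ => by
      rw [mul_inv, inv_inv]; ring_nf
  · exact IsLaurent.zero

theorem isLaurent_vertexWeight_of_ne (a y : F) {l r : Bool} (hlr : l ≠ r) (d t : Bool) :
    IsLaurent S 0 fun q => vertexWeight a (q * y⁻¹) l r d t := by
  unfold vertexWeight
  split_ifs
  · exact IsLaurent.const _
  · exact IsLaurent.zero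

theorem tail_mul_inv {n : ℕ} (q : F) (y : Fin (n + 1) → F) :
    (Fin.tail fun j => q * (y j)⁻¹) = fun j => q * (Fin.tail y j)⁻¹ := rfl

/-- A turning vertex has constant weight, so the number of turns fixes the parity of the exponents.
For reversed rows the crude bound n + 1 has the right parity and is enough to close the joint
induction. -/
theorem isLaurent_lineOp_aux (hS : ∀ t ∈ S, t ≠ 0) (a : F) {n : ℕ} (y : Fin n → F) (l : Bool)
    (t d : Fin n → Bool) :
    IsLaurent S n (fun q => lineOp a (fun j => q * (y j)⁻¹) l l t d) ∧
      IsLaurent S (n + 1) (fun q => lineOp a (fun j => q * (y j)⁻¹) l (!l) t d) := by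
  induction n generalizing l with
  | zero =>
    simp only [lineOp_zero]
    exact ⟨by simpa using IsLaurent.const 1, by simpa using IsLaurent.zero⟩
  | succ n ih =>
    have ih1 := ih (Fin.tail y) l (Fin.tail t) (Fin.tail d)
    have ih2 := ih (Fin.tail y) (!l) (Fin.tail t) (Fin.tail d)
    rw [Bool.not_not] at ih2
    have e : ∀ q r, lineOp a (fun j => q * (y j)⁻¹) l r t d =
        vertexWeight a (q * (y 0)⁻¹) l l (d 0) (t 0) *
          lineOp a (fun j => q * (Fin.tail y j)⁻¹) l r (Fin.tail t) (Fin.tail d) +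
        vertexWeight a (q * (y 0)⁻¹) l (!l) (d 0) (t 0) *
          lineOp a (fun j => q * (Fin.tail y j)⁻¹) (!l) r (Fin.tail t) (Fin.tail d) := by
      intro q r
      rw [lineOp_succ, tail_mul_inv, Fintype.sum_bool]
      cases l
      · exact add_comm _ _
      · rfl
    have h1 := isLaurent_vertexWeight hS a (y 0) l (d 0) (t 0)
    have h2 := isLaurent_vertexWeight_of_ne (S := S) a (y 0) (l := l) (r := !l) (by simp) (d 0) (t 0)
    simp only [e]
    constructor
    · exact ((h1.mul ih1.1).of_eq (by ring)).add ((h2.mul ih2.2).of_eq (by ring))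
    · exact ((h1.mul ih1.2).of_eq (by ring)).add ((h2.mul ih2.1).add_two.of_eq (by ring))

theorem isLaurent_lineOp (hS : ∀ t ∈ S, t ≠ 0) (a : F) {n : ℕ} (y : Fin n → F) (l : Bool)
    (t d : Fin n → Bool) : IsLaurent S n (fun q => lineOp a (fun j => q * (y j)⁻¹) l l t d) :=
  (isLaurent_lineOp_aux hS a y l t d).1

/-- A reversed row turns at least once, at a vertex of constant weight, and so loses one degree.
This sharp bound makes the number of interpolation points sufficient. -/
theorem isLaurent_lineOp_of_ne (hS : ∀ t ∈ S, t ≠ 0) (a : F) {n : ℕ} (y : Fin (n + 1) → F)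
    {l r : Bool} (hlr : l ≠ r) (t d : Fin (n + 1) → Bool) :
    IsLaurent S n (fun q => lineOp a (fun j => q * (y j)⁻¹) l r t d) := by
  obtain rfl : r = !l := by revert hlr; cases l <;> cases r <;> simp
  have e : ∀ {n : ℕ} (y : Fin (n + 1) → F) (t d : Fin (n + 1) → Bool) q,
      lineOp a (fun j => q * (y j)⁻¹) l (!l) t d =
        vertexWeight a (q * (y 0)⁻¹) l l (d 0) (t 0) *
          lineOp a (fun j => q * (Fin.tail y j)⁻¹) l (!l) (Fin.tail t) (Fin.tail d) +
        vertexWeight a (q * (y 0)⁻¹) l (!l) (d 0) (t 0) *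
          lineOp a (fun j => q * (Fin.tail y j)⁻¹) (!l) (!l) (Fin.tail t) (Fin.tail d) := by
    intro n y t d q
    rw [lineOp_succ, tail_mul_inv, Fintype.sum_bool]
    cases l
    · exact add_comm _ _
    · rfl
  have h2 : ∀ {n : ℕ} (y : Fin (n + 1) → F) (t d : Fin (n + 1) → Bool),
      IsLaurent S n fun q => vertexWeight a (q * (y 0)⁻¹) l (!l) (d 0) (t 0) *
          lineOp a (fun j => q * (Fin.tail y j)⁻¹) (!l) (!l) (Fin.tail t) (Fin.tail d) := by
    intro n y t d
    have := (isLaurent_vertexWeight_of_ne (S := S) a (y 0) (l := l) (r := !l) (by simp)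
      (d 0) (t 0)).mul (isLaurent_lineOp hS a (Fin.tail y) (!l) (Fin.tail t) (Fin.tail d))
    rwa [zero_add] at this
  induction n with
  | zero =>
    simp only [e]
    simp only [lineOp_zero (l := l)]
    simpa using h2 y t d
  | succ n ih =>
    simp only [e y]
    refine IsLaurent.add ?_ (h2 y t d)
    exact ((isLaurent_vertexWeight hS a (y 0) l (d 0) (t 0)).mul (ih _ _ _)).of_eq (by ring)

end Line

/-! ### Kuperberg's determinant for the second factor -/

theorem sigma_ne_zero {q : F} (hq : q ≠ 0) (h : q ^ 2 ≠ 1) : sigma q ≠ 0 := by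
  intro h'
  apply h
  rw [sigma, sub_eq_zero] at h'
  calc q ^ 2 = q * q⁻¹ := by rw [← h', sq]
    _ = 1 := mul_inv_cancel₀ hq

theorem sigma_inv (q : F) : sigma q⁻¹ = -sigma q := by simp [sigma]

theorem signPow_ne_zero (c : Bool) {q : F} (hq : q ≠ 0) : signPow c q ≠ 0 := by
  cases c <;> simpa

/-- The product `σ(a x / y) σ(a y / x)`. -/
def pairWeight (a x y : F) : F := sigma (a * (x * y⁻¹)) * sigma (a * (x * y⁻¹)⁻¹)

/-- The matrix of the determinant formula for the second factor. -/
def factorMatrix (a : F) {n : ℕ} (x y : Fin n → F) : Matrix (Fin n) (Fin n) F :=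
  .of fun i j => (sigma (a * (x i * (y j)⁻¹)) + sigma (a * (x i * (y j)⁻¹)⁻¹)) *
    ∏ k, if k = j then 1 else pairWeight a (x i) (y k)

/-- The product of `σ(x i / x j)` over `i < j`. -/
def sigmaVandermonde {n : ℕ} (x : Fin n → F) : F :=
  (∏ i, x i ^ (n - 1)) * (Matrix.vandermonde fun i => (x i ^ 2)⁻¹).det

/-- The determinant formula for the second factor of the half-turn partition function. -/
def factorDet (a : F) {n : ℕ} (x y : Fin n → F) : F :=
  (factorMatrix a x y).det / (sigmaVandermonde x * sigmaVandermonde fun j => (y j)⁻¹)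

theorem sigmaVandermonde_perm {n : ℕ} (x : Fin n → F) (π : Equiv.Perm (Fin n)) :
    sigmaVandermonde (x ∘ π) = Equiv.Perm.sign π * sigmaVandermonde x := by
  have h : (Matrix.vandermonde fun i => ((x ∘ π) i ^ 2)⁻¹) =
      (Matrix.vandermonde fun i => (x i ^ 2)⁻¹).submatrix π id := by
    ext i j
    simp [Matrix.vandermonde_apply]
  rw [sigmaVandermonde, h, Matrix.det_permute, sigmaVandermonde]
  simp only [Function.comp_apply]
  rw [Equiv.prod_comp π fun i => x i ^ (n - 1)]
  ring

theorem sigmaVandermonde_cons {n : ℕ} {t : F} (x : Fin n → F) (ht : t ≠ 0) (hx : ∀ i, x i ≠ 0) :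
    sigmaVandermonde (Fin.cons t x : Fin (n + 1) → F) =
      (∏ i, sigma (t * (x i)⁻¹)) * sigmaVandermonde x := by
  have e : ∀ i, sigma (t * (x i)⁻¹) = t * x i * ((x i ^ 2)⁻¹ - (t ^ 2)⁻¹) := fun i => by
    have := hx i
    simp only [sigma]
    field_simp
  have e2 : ∏ i, x i ^ n = (∏ i, x i) * ∏ i, x i ^ (n - 1) := by
    rw [← Finset.prod_mul_distrib]
    refine Finset.prod_congr rfl fun i _ => ?_
    obtain ⟨k, rfl⟩ : ∃ k, n = k + 1 := ⟨n - 1, by have := i.pos; omega⟩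
    rw [Nat.add_sub_cancel, pow_succ']
  simp only [sigmaVandermonde, Matrix.det_vandermonde, Fin.prod_univ_succ, Fin.cons_zero,
    Fin.cons_succ, Fin.prod_Ioi_zero, Fin.prod_Ioi_succ, Nat.add_sub_cancel, e,
    Finset.prod_mul_distrib, Finset.prod_const, Finset.card_univ, Fintype.card_fin, e2]
  ring

theorem factorDet_perm_left (a : F) {n : ℕ} (x y : Fin n → F) (π : Equiv.Perm (Fin n)) :
    factorDet a (x ∘ π) y = factorDet a x y := by
  have h : factorMatrix a (x ∘ π) y = (factorMatrix a x y).submatrix π id := rfl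
  rw [factorDet, h, Matrix.det_permute, sigmaVandermonde_perm, factorDet, mul_assoc,
    mul_div_mul_left]
  rcases Int.units_eq_one_or (Equiv.Perm.sign π) with h | h <;> simp [h]

theorem factorDet_perm_right (a : F) {n : ℕ} (x y : Fin n → F) (π : Equiv.Perm (Fin n)) :
    factorDet a x (y ∘ π) = factorDet a x y := by
  have h : factorMatrix a x (y ∘ π) = (factorMatrix a x y).submatrix id π := by
    ext i j
    simp only [factorMatrix, Matrix.of_apply, Matrix.submatrix_apply, id, Function.comp_apply]
    congr 1
    rw [← Equiv.prod_comp π fun k => if k = π j then 1 else pairWeight a (x i) (y k)]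
    simp only [π.injective.eq_iff]
  rw [factorDet, h, Matrix.det_permute', factorDet,
    show (fun j => ((y ∘ π) j)⁻¹) = (fun j => (y j)⁻¹) ∘ π from rfl, sigmaVandermonde_perm,
    mul_left_comm, mul_div_mul_left]
  rcases Int.units_eq_one_or (Equiv.Perm.sign π) with h | h <;> simp [h]

theorem isLaurent_pairWeight {S : Set F} (hS : ∀ t ∈ S, t ≠ 0) (a y : F) :
    IsLaurent S 2 fun q => pairWeight a q y :=
  ((IsLaurent.sigma_mul hS (a * y⁻¹)).mul (IsLaurent.sigma_mul_inv hS (a * y))).congr fun q _ => by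
    rw [pairWeight, mul_inv, inv_inv]
    congr 2 <;> ring

/-- Only the first row involves t. Each of its entries has degree 1 from the sum of two σ and degree
2 from each of the n factors `pairWeight`. -/
theorem isLaurent_det_factorMatrix {S : Set F} (hS : ∀ t ∈ S, t ≠ 0) (a : F) {n : ℕ}
    (x : Fin n → F) (y : Fin (n + 1) → F) :
    IsLaurent S (n + 1 + n) fun t => (factorMatrix a (Fin.cons t x : Fin (n + 1) → F) y).det := by
  simp only [Matrix.det_succ_row_zero]
  refine IsLaurent.sum _ fun j _ => ?_
  have e : ∀ t, (factorMatrix a (Fin.cons t x : Fin (n + 1) → F) y).submatrix Fin.succ j.succAbove =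
      .of fun i k => factorMatrix a (Fin.cons 1 x : Fin (n + 1) → F) y i.succ (j.succAbove k) := by
    intro t
    ext i k
    simp [factorMatrix]
  simp only [e]
  refine IsLaurent.mul_const (IsLaurent.const_mul ?_ _) _
  have e2 : ∀ t, factorMatrix a (Fin.cons t x : Fin (n + 1) → F) y 0 j =
      (sigma (a * (t * (y j)⁻¹)) + sigma (a * (t * (y j)⁻¹)⁻¹)) *
        ∏ k, pairWeight a t (y (j.succAbove k)) := by
    intro t
    simp [factorMatrix, Fin.prod_univ_succAbove _ j, Fin.succAbove_ne]
  simp only [e2]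
  have h1 : IsLaurent S 1 fun t => sigma (a * (t * (y j)⁻¹)) + sigma (a * (t * (y j)⁻¹)⁻¹) :=
    ((IsLaurent.sigma_mul hS (a * (y j)⁻¹)).add (IsLaurent.sigma_mul_inv hS (a * y j))).congr
      fun q _ => by
        rw [mul_inv, inv_inv]
        congr 2 <;> ring
  have h2 := IsLaurent.prod (S := S) Finset.univ fun k (_ : k ∈ Finset.univ) =>
    isLaurent_pairWeight hS a (y (j.succAbove k))
  exact (h1.mul h2).of_eq (by rw [Finset.card_univ, Fintype.card_fin]; ring)

theorem det_factorMatrix_cons_eq_zero (a : F) {n : ℕ} (x : Fin n → F) (y : Fin (n + 1) → F)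
    (i : Fin n) : (factorMatrix a (Fin.cons (x i) x : Fin (n + 1) → F) y).det = 0 := by
  refine Matrix.det_zero_of_row_eq (i := 0) (j := i.succ) (Fin.succ_ne_zero i).symm ?_
  ext j
  simp [factorMatrix]

/-- The determinant has degree 2n + 1 and vanishes at t = x_i, where two rows coincide. Hence the n
factors of the Vandermonde product which contain t divide it, leaving degree n + 1. The values with
t² = x_i² are excluded because the quotient is a division by zero there. -/
theorem isLaurent_factorDet (a : F) {n : ℕ} (x : Fin n → F) (y : Fin (n + 1) → F)
    (hx : ∀ i, x i ≠ 0) (hxx : Function.Injective fun i => x i ^ 2) :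
    IsLaurent {t | t ≠ 0 ∧ ∀ i, t ^ 2 ≠ x i ^ 2} (n + 1) fun t =>
      factorDet a (Fin.cons t x : Fin (n + 1) → F) y := by
  have hS : ∀ t ∈ {t : F | t ≠ 0}, t ≠ 0 := fun t ht => ht
  obtain ⟨g, hg, h⟩ := IsLaurent.exists_eq_prod_mul hS (isLaurent_det_factorMatrix hS a x y) x hx hxx
    (det_factorMatrix_cons_eq_zero a x y)
  refine ((hg.mono fun t ht => ht.1).mul_const
    (sigmaVandermonde x * sigmaVandermonde fun j => (y j)⁻¹)⁻¹).congr fun t ht => ?_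
  have h0 : ∏ i, sigma (t * (x i)⁻¹) ≠ 0 := by
    refine Finset.prod_ne_zero_iff.2 fun i _ => sigma_ne_zero (mul_ne_zero ht.1 (inv_ne_zero (hx i))) ?_
    rw [mul_pow, inv_pow]
    intro h'
    exact ht.2 i (by rwa [mul_inv_eq_one₀ (pow_ne_zero 2 (hx i))] at h')
  rw [factorDet, h t ht.1, sigmaVandermonde_cons x ht.1 hx, mul_assoc, mul_div_mul_left _ _ h0,
    div_eq_mul_inv]

theorem pairWeight_signPow {a y : F} (ha : a ≠ 0) (hy : y ≠ 0) (c : Bool) :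
    pairWeight a (signPow c a * y) y = 0 := by
  cases c <;> simp [pairWeight, ha, hy]

/-- At t = a^{±1}y₀ the factor `pairWeight a t y₀` vanishes, so only the first entry of the first
row survives. Half of the remaining σ factors cancel against the Vandermonde products; what is left
is the factor that a frozen corner gives to the domain wall partition function. -/
theorem factorDet_corner {a : F} (ha : a ≠ 0) {n : ℕ} (c : Bool) (x y : Fin n → F) (y₀ : F)
    (hy₀ : y₀ ≠ 0) (hx : ∀ i, x i ≠ 0) (hy : ∀ i, y i ≠ 0)
    (hx' : ∀ i, (signPow c a * y₀) ^ 2 ≠ x i ^ 2) (hy' : ∀ j, y₀ ^ 2 ≠ y j ^ 2) :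
    factorDet a (Fin.cons (signPow c a * y₀) x : Fin (n + 1) → F) (Fin.cons y₀ y) =
      sigma (a ^ 2) * (∏ j, sigma (a * signPow c (signPow c a * y₀ * (y j)⁻¹))) *
        (∏ i, sigma (a * signPow c (x i * y₀⁻¹))) * factorDet a x y := by
  set t := signPow c a * y₀ with ht
  have ht0 : t ≠ 0 := mul_ne_zero (signPow_ne_zero c ha) hy₀
  have hp : pairWeight a t y₀ = 0 := pairWeight_signPow ha hy₀ c
  have hdet : (factorMatrix a (Fin.cons t x : Fin (n + 1) → F) (Fin.cons y₀ y)).det =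
      sigma (a ^ 2) * (∏ j, pairWeight a t (y j)) * ((∏ i, pairWeight a (x i) y₀) *
        (factorMatrix a x y).det) := by
    rw [Matrix.det_succ_row_zero, Fin.sum_univ_succ, Finset.sum_eq_zero, add_zero]
    · have e : (factorMatrix a (Fin.cons t x : Fin (n + 1) → F) (Fin.cons y₀ y)).submatrix Fin.succ
          (Fin.succAbove 0) = .of fun i j => pairWeight a (x i) y₀ * factorMatrix a x y i j := by
        ext i j
        simp [factorMatrix, Fin.prod_univ_succ, (Fin.succ_ne_zero _).symm]
        ring
      rw [e, Matrix.det_mul_column]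
      have : sigma (a * (t * y₀⁻¹)) + sigma (a * (t * y₀⁻¹)⁻¹) = sigma (a ^ 2) := by
        rw [ht, mul_inv_cancel_right₀ hy₀]
        cases c <;> simp [ha, sq]
      rw [mul_inv_rev, inv_inv] at this
      simp [factorMatrix, Fin.prod_univ_succ, this]
    · intro j _
      simp [factorMatrix, Fin.prod_univ_succ, (Fin.succ_ne_zero _).symm, hp]
  have hcons : (fun j => ((Fin.cons y₀ y : Fin (n + 1) → F) j)⁻¹) =
      Fin.cons y₀⁻¹ fun j => (y j)⁻¹ := by
    ext j
    refine Fin.cases ?_ (fun i => ?_) j <;> simp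
  rw [factorDet, hdet, hcons, sigmaVandermonde_cons x ht0 hx,
    sigmaVandermonde_cons _ (inv_ne_zero hy₀) fun j => inv_ne_zero (hy j), factorDet]
  have hX : ∏ i, sigma (t * (x i)⁻¹) ≠ 0 := by
    refine Finset.prod_ne_zero_iff.2 fun i _ => sigma_ne_zero (mul_ne_zero ht0 (inv_ne_zero (hx i))) ?_
    rw [mul_pow, inv_pow, Ne, mul_inv_eq_one₀ (pow_ne_zero 2 (hx i))]
    exact hx' i
  have hY : ∏ i, sigma (y₀⁻¹ * (y i)⁻¹⁻¹) ≠ 0 := by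
    refine Finset.prod_ne_zero_iff.2 fun i _ => sigma_ne_zero (by simp [hy₀, hy i]) ?_
    rw [inv_inv, mul_pow, inv_pow, Ne, inv_mul_eq_one₀ (pow_ne_zero 2 hy₀)]
    exact hy' i
  have key : (∏ j, pairWeight a t (y j)) * ∏ i, pairWeight a (x i) y₀ =
      (∏ j, sigma (a * signPow c (t * (y j)⁻¹))) * (∏ i, sigma (a * signPow c (x i * y₀⁻¹))) *
        ((∏ i, sigma (t * (x i)⁻¹)) * ∏ i, sigma (y₀⁻¹ * (y i)⁻¹⁻¹)) := by
    cases c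
    · have e1 : ∀ j, pairWeight a t (y j) =
          sigma (a * signPow false (t * (y j)⁻¹)) * (-1 * sigma (y₀⁻¹ * (y j)⁻¹⁻¹)) := fun j => by
        rw [neg_one_mul, ← sigma_inv, pairWeight, ht]
        simp only [signPow_false, mul_inv, inv_inv]
        rw [mul_comm]
        congr 2
        field_simp
      have e2 : ∀ i, pairWeight a (x i) y₀ =
          sigma (a * signPow false (x i * y₀⁻¹)) * (-1 * sigma (t * (x i)⁻¹)) := fun i => by
        rw [neg_one_mul, ← sigma_inv, pairWeight, ht]
        simp only [signPow_false, mul_inv, inv_inv]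
        rw [mul_comm]
        congr 2
        ring
      simp only [e1, e2, Finset.prod_mul_distrib]
      -- For a⁻¹ the arguments of σ are inverted in two products of n factors each, so the signs
      -- cancel.
      have : ((∏ _i : Fin n, (-1 : F)) * ∏ _i : Fin n, (-1 : F)) = 1 := by
        simp [← mul_pow]
      linear_combination ((∏ j, sigma (a * signPow false (t * (y j)⁻¹))) *
        (∏ i, sigma (a * signPow false (x i * y₀⁻¹))) *
        ((∏ i, sigma (t * (x i)⁻¹)) * ∏ i, sigma (y₀⁻¹ * (y i)⁻¹⁻¹))) * this
    · have e1 : ∀ j, pairWeight a t (y j) =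
          sigma (a * signPow true (t * (y j)⁻¹)) * sigma (y₀⁻¹ * (y j)⁻¹⁻¹) := fun j => by
        rw [pairWeight, ht]
        simp only [signPow_true, mul_inv, inv_inv]
        congr 2
        field_simp
      have e2 : ∀ i, pairWeight a (x i) y₀ =
          sigma (a * signPow true (x i * y₀⁻¹)) * sigma (t * (x i)⁻¹) := fun i => by
        rw [pairWeight, ht]
        simp only [signPow_true, mul_inv, inv_inv]
        congr 2
        ring
      simp only [e1, e2, Finset.prod_mul_distrib]
      ring
  rw [show sigma (a ^ 2) * (∏ j, pairWeight a t (y j)) * ((∏ i, pairWeight a (x i) y₀) *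
      (factorMatrix a x y).det) = ((∏ i, sigma (t * (x i)⁻¹)) * ∏ i, sigma (y₀⁻¹ * (y i)⁻¹⁻¹)) *
      (sigma (a ^ 2) * ((∏ j, sigma (a * signPow c (t * (y j)⁻¹))) *
        (∏ i, sigma (a * signPow c (x i * y₀⁻¹)))) * (factorMatrix a x y).det) by
      linear_combination sigma (a ^ 2) * (factorMatrix a x y).det * key,
    mul_mul_mul_comm (∏ i, sigma (t * (x i)⁻¹)) (sigmaVandermonde x),
    mul_div_mul_left _ _ (mul_ne_zero hX hY)]
  ring

/-! ### Generic points -/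

/-- The squares of `p` and `q` do not differ by an integral power of `a`. -/
def ScaleIndep (a p q : F) : Prop := ∀ e : ℤ, p ^ 2 ≠ a ^ e * q ^ 2

theorem ScaleIndep.symm {a p q : F} (ha : a ≠ 0) (h : ScaleIndep a p q) : ScaleIndep a q p := by
  intro e he
  apply h (-e)
  rw [he, ← mul_assoc, ← zpow_add₀ ha]
  simp

theorem ScaleIndep.sq_ne {a p q : F} (h : ScaleIndep a p q) : p ^ 2 ≠ q ^ 2 := by
  simpa using h 0

theorem signPow_eq_zpow (c : Bool) (a : F) : signPow c a = a ^ (if c then 1 else -1 : ℤ) := by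
  cases c <;> simp

theorem ScaleIndep.signPow_mul_left {a p q : F} (ha : a ≠ 0) (h : ScaleIndep a p q) (c : Bool) :
    ScaleIndep a (signPow c a * p) q := by
  intro e he
  rw [signPow_eq_zpow] at he
  apply h (e - (if c then 1 else -1) * 2)
  rw [mul_pow, ← zpow_natCast, ← zpow_mul] at he
  rw [zpow_sub₀ ha, div_mul_eq_mul_div, eq_div_iff (zpow_ne_zero _ ha), ← he, mul_comm]
  rfl

theorem ScaleIndep.signPow_mul_right {a p q : F} (ha : a ≠ 0) (h : ScaleIndep a p q) (c : Bool) :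
    ScaleIndep a p (signPow c a * q) :=
  ((h.symm ha).signPow_mul_left ha c).symm ha

theorem ScaleIndep.sigma_ne_zero {a p q : F} (ha : a ≠ 0) (hp : p ≠ 0) (hq : q ≠ 0)
    (h : ScaleIndep a p q) : sigma (a * (a * p * q⁻¹)) ≠ 0 := by
  refine SquareIce.sigma_ne_zero (by simp [ha, hp, hq]) fun h' => h (-4) ?_
  rw [zpow_neg, eq_inv_mul_iff_mul_eq₀ (zpow_ne_zero _ ha)]
  have : a ^ (4 : ℤ) = a ^ 4 := by norm_cast
  rw [this]
  field_simp at h'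
  linear_combination h'

/-- The spectral parameters `x` and `y` are nonzero, and no two of their squares differ by
an integral power of `a`. -/
structure Generic (a : F) {m n : ℕ} (x : Fin m → F) (y : Fin n → F) : Prop where
  left_ne : ∀ i, x i ≠ 0
  right_ne : ∀ j, y j ≠ 0
  left : ∀ i j, i ≠ j → ScaleIndep a (x i) (x j)
  right : ∀ i j, i ≠ j → ScaleIndep a (y i) (y j)
  cross : ∀ i j, ScaleIndep a (x i) (y j)

theorem Generic.comp {a : F} {m n m' n' : ℕ} {x : Fin m → F} {y : Fin n → F} (h : Generic a x y)
    {f : Fin m' → Fin m} {g : Fin n' → Fin n} (hf : Function.Injective f)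
    (hg : Function.Injective g) : Generic a (x ∘ f) (y ∘ g) where
  left_ne _ := h.left_ne _
  right_ne _ := h.right_ne _
  left _ _ hij := h.left _ _ (hf.ne hij)
  right _ _ hij := h.right _ _ (hg.ne hij)
  cross _ _ := h.cross _ _

theorem Generic.of_cons_left {a t : F} {m n : ℕ} {x : Fin m → F} {y : Fin n → F}
    (h : Generic a (Fin.cons t x : Fin (m + 1) → F) y) : Generic a x y := by
  simpa [Function.comp_def] using h.comp (Fin.succ_injective m) Function.injective_id

theorem Generic.of_cons_right {a t : F} {m n : ℕ} {x : Fin m → F} {y : Fin n → F}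
    (h : Generic a x (Fin.cons t y : Fin (n + 1) → F)) : Generic a x y := by
  simpa [Function.comp_def] using h.comp Function.injective_id (Fin.succ_injective n)

theorem Generic.of_snoc_left {a t : F} {m n : ℕ} {x : Fin m → F} {y : Fin n → F}
    (h : Generic a (Fin.snoc x t : Fin (m + 1) → F) y) : Generic a x y := by
  simpa [Function.comp_def] using h.comp (Fin.castSucc_injective m) Function.injective_id

theorem Generic.of_snoc_right {a t : F} {m n : ℕ} {x : Fin m → F} {y : Fin n → F}
    (h : Generic a x (Fin.snoc y t : Fin (n + 1) → F)) : Generic a x y := by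
  simpa [Function.comp_def] using h.comp Function.injective_id (Fin.castSucc_injective n)

/-- A scaled spectral parameter of one kind may be used as a parameter of the other kind. -/
theorem Generic.cons_left {a t : F} (ha : a ≠ 0) {m n : ℕ} {x : Fin m → F} {y : Fin n → F}
    (h : Generic a x (Fin.cons t y : Fin (n + 1) → F)) (c : Bool) :
    Generic a (Fin.cons (signPow c a * t) x : Fin (m + 1) → F) y := by
  have ht : t ≠ 0 := by simpa using h.right_ne 0
  have hxt : ∀ i, ScaleIndep a (x i) t := fun i => by simpa using h.cross i 0
  have hyt : ∀ j, ScaleIndep a t (y j) := fun j => by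
    simpa using h.right 0 j.succ (Fin.succ_ne_zero j).symm
  refine ⟨fun i => ?_, h.of_cons_right.right_ne, fun i j hij => ?_, h.of_cons_right.right,
    fun i j => ?_⟩
  · refine Fin.cases ?_ (fun i => ?_) i
    · simp [signPow_ne_zero c ha, ht]
    · simpa using h.left_ne i
  · revert hij
    refine Fin.cases ?_ (fun i => ?_) i <;> refine Fin.cases ?_ (fun j => ?_) j
    · simp
    · simpa [(Fin.succ_ne_zero j).symm] using ((hxt j).symm ha).signPow_mul_left ha c
    · simpa [Fin.succ_ne_zero] using (hxt i).signPow_mul_right ha c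
    · simpa using h.left i j
  · refine Fin.cases ?_ (fun i => ?_) i
    · simpa using (hyt j).signPow_mul_left ha c
    · simpa using h.of_cons_right.cross i j

theorem Generic.snoc_left {a t : F} (ha : a ≠ 0) {m n : ℕ} {x : Fin m → F} {y : Fin n → F}
    (h : Generic a x (Fin.snoc y t : Fin (n + 1) → F)) (c : Bool) :
    Generic a (Fin.snoc x (signPow c a * t) : Fin (m + 1) → F) y := by
  have h1 : Generic a x (Fin.cons t y : Fin (n + 1) → F) := by
    have := h.comp Function.injective_id (finRotate (n + 1)).symm.injective
    rw [Fin.snoc_eq_cons_rotate] at this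
    simpa [Function.comp_def] using this
  have := (h1.cons_left ha c).comp (finRotate (m + 1)).injective Function.injective_id
  rw [Fin.snoc_eq_cons_rotate]
  exact this

/-! ### The points of interpolation -/

/-- For one column the squares of the two points have ratio a⁴ ≠ 1; for different columns genericity
separates them. -/
theorem signPow_sq_injective {a : F} (ha : a ≠ 0) (ha4 : a ^ 4 ≠ 1) {n : ℕ} {m : ℕ} {x : Fin m → F}
    {y : Fin n → F} (h : Generic a x y) :
    Function.Injective fun i : Bool × Fin n => (signPow i.1 a * y i.2) ^ 2 := by
  rintro ⟨c, i⟩ ⟨c', j⟩ hij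
  simp only at hij
  by_cases hne : i = j
  · subst hne
    have hy := h.right_ne i
    have hy2 : y i ^ 2 ≠ 0 := pow_ne_zero 2 hy
    rw [mul_pow, mul_pow] at hij
    have h1 := mul_right_cancel₀ hy2 hij
    congr 1
    revert h1
    cases c <;> cases c' <;> simp only [signPow_true, signPow_false, reduceCtorEq, imp_false,
      imp_self]
    all_goals
      intro h1
      apply ha4
      field_simp at h1
      first | exact h1 | exact h1.symm
  · exact absurd hij (((h.right i j hne).signPow_mul_left ha c).signPow_mul_right ha c').sq_ne

/-- The transfer matrix of a row with parameter `x`, with incoming left edge and right edge `r`. -/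
abbrev rowOp (a : F) {n : ℕ} (y : Fin n → F) (x : F) (r : Bool) :
    Matrix (Fin n → Bool) (Fin n → Bool) F :=
  lineOp a (fun j => x * (y j)⁻¹) true r

/-- The entry of an operator for the domain wall states of the vertical edges. -/
abbrev wallEntry {n : ℕ} (M : Matrix (Fin n → Bool) (Fin n → Bool) F) : F :=
  M (fun _ => true) (fun _ => false)

theorem firstBlock_rowOp (a : F) {n : ℕ} (c : Bool) (y₀ : F) (y : Fin n → F) (x : F) (r : Bool) :
    firstBlock c (rowOp a (Fin.cons y₀ y : Fin (n + 1) → F) x r) =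
      sigma (a * signPow c (x * y₀⁻¹)) • rowOp a y x r := by
  rw [rowOp, firstBlock_lineOp, tail_mul_inv, Fin.tail_cons, Fin.cons_zero]

/-! ### The domain wall partition function -/

theorem partitionDW_eq_gridSum (n : ℕ) (a : F) (x y : Fin n → F) :
    partitionDW n a x y = gridSum a (fun i j => x i * (y j)⁻¹) (fun _ => true) (fun _ => false)
      (fun _ => true) (fun _ => false) := rfl

theorem partitionDW_perm_right {n : ℕ} {a : F} (ha : a ≠ 0) (x y : Fin n → F) (hx : ∀ i, x i ≠ 0)
    (hy : ∀ j, y j ≠ 0) (hyy : ∀ i j, i ≠ j → ScaleIndep a (y i) (y j)) (π : Equiv.Perm (Fin n)) :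
    partitionDW n a x (y ∘ π) = partitionDW n a x y := by
  rw [partitionDW_eq_gridSum, partitionDW_eq_gridSum]
  exact gridSum_perm ha x y hx hy
    (fun i j hij => (hyy i j hij).sigma_ne_zero ha (hy i) (hy j)) _ _ π

theorem partitionDW_transpose (n : ℕ) (a : F) (x y : Fin n → F) :
    partitionDW n a x y = partitionDW n a (fun i => (y i)⁻¹) (fun i => (x i)⁻¹) := by
  rw [partitionDW_eq_gridSum, partitionDW_eq_gridSum, gridSum_transpose]
  simp only [inv_inv, mul_comm]

theorem partitionDW_perm_left {n : ℕ} {a : F} (ha : a ≠ 0) (x y : Fin n → F) (hx : ∀ i, x i ≠ 0)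
    (hy : ∀ j, y j ≠ 0) (hxx : ∀ i j, i ≠ j → ScaleIndep a (x i) (x j)) (π : Equiv.Perm (Fin n)) :
    partitionDW n a (x ∘ π) y = partitionDW n a x y := by
  rw [partitionDW_transpose, partitionDW_transpose n a x]
  refine partitionDW_perm_right ha _ (fun i => (x i)⁻¹) (fun i => inv_ne_zero (hy i))
    (fun i => inv_ne_zero (hx i)) (fun i j hij e he => hxx j i hij.symm e ?_) π
  have hi := hx i
  have hj := hx j
  rw [inv_pow, inv_pow] at he
  field_simp at he
  linear_combination he

/-- The product of the transfer matrices of rows whose right edges enter. -/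
def wallRows (a : F) {m n : ℕ} (x : Fin m → F) (y : Fin n → F) :
    Matrix (Fin n → Bool) (Fin n → Bool) F :=
  (List.ofFn fun i => rowOp a y (x i) false).prod

theorem partitionDW_eq_wallRows (n : ℕ) (a : F) (x y : Fin n → F) :
    partitionDW n a x y = wallEntry (wallRows a x y) := by
  rw [partitionDW_eq_gridSum, gridSum_eq_rows, wallRows]

theorem wallRows_cons (a : F) {m n : ℕ} (t : F) (x : Fin m → F) (y : Fin n → F) :
    wallRows a (Fin.cons t x : Fin (m + 1) → F) y = rowOp a y t false * wallRows a x y := by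
  rw [wallRows, List.ofFn_succ, List.prod_cons]
  rfl

theorem wallRows_snoc (a : F) {m n : ℕ} (t : F) (x : Fin m → F) (y : Fin n → F) :
    wallRows a (Fin.snoc x t : Fin (m + 1) → F) y = wallRows a x y * rowOp a y t false := by
  rw [wallRows, List.ofFn_succ', List.concat_eq_append, List.prod_append, List.prod_singleton]
  simp only [Fin.snoc_castSucc, Fin.snoc_last]
  rfl

theorem isFirstTriangular_wallRows (a : F) {m n : ℕ} (x : Fin m → F) (y : Fin (n + 1) → F) :
    IsFirstTriangular (wallRows a x y) := by
  induction m with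
  | zero => simpa [wallRows] using isFirstTriangular_one
  | succ m ih =>
    rw [← Fin.cons_self_tail x, wallRows_cons]
    exact (isFirstTriangular_lineOp a _ _).mul (ih _)

theorem firstBlock_wallRows (a : F) {m n : ℕ} (c : Bool) (x : Fin m → F) (y₀ : F) (y : Fin n → F) :
    firstBlock c (wallRows a x (Fin.cons y₀ y : Fin (n + 1) → F)) =
      (∏ i, sigma (a * signPow c (x i * y₀⁻¹))) • wallRows a x y := by
  induction m with
  | zero => simp [wallRows]
  | succ m ih =>
    rw [← Fin.cons_self_tail x, wallRows_cons, firstBlock_mul c (isFirstTriangular_lineOp a _ _)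
      (isFirstTriangular_wallRows a _ _), firstBlock_rowOp, ih, wallRows_cons, Fin.prod_univ_succ]
    simp only [Fin.cons_zero, Fin.cons_succ, smul_mul_assoc, mul_smul_comm, smul_smul]
    exact congrArg (· • _) (mul_comm _ _)

/-- The factor gained by freezing the corner at the crossing of the lines `y₀` and
`t = a^{±1} y₀`. -/
def cornerFactor (a : F) {m n : ℕ} (c : Bool) (x : Fin m → F) (y₀ : F) (y : Fin n → F) : F :=
  sigma (a ^ 2) * (∏ j, sigma (a * signPow c (signPow c a * y₀ * (y j)⁻¹))) *
    ∏ i, sigma (a * signPow c (x i * y₀⁻¹))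

theorem partitionDW_corner_top {n : ℕ} {a : F} (ha : a ≠ 0) (x y : Fin n → F) {y₀ : F}
    (hy₀ : y₀ ≠ 0) :
    partitionDW (n + 1) a (Fin.cons (a⁻¹ * y₀) x) (Fin.cons y₀ y) =
      cornerFactor a false x y₀ y * partitionDW n a x y := by
  rw [partitionDW_eq_wallRows, wallRows_cons]
  refine (corner_entry_top ha _ ?_ _).trans ?_
  · simp [hy₀]
  · rw [firstBlock_wallRows, Matrix.smul_apply, partitionDW_eq_wallRows, cornerFactor]
    simp only [Fin.cons_succ, smul_eq_mul, signPow_false]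
    ring

/-- For a⁻¹y₀ the upper left corner freezes. For a y₀ it is the lower left one, so the new row is
first moved to the bottom by symmetry in the row parameters. -/
theorem partitionDW_corner {n : ℕ} {a : F} (ha : a ≠ 0) (c : Bool) (x y : Fin n → F) (y₀ : F)
    (hg : Generic a x (Fin.cons y₀ y : Fin (n + 1) → F)) :
    partitionDW (n + 1) a (Fin.cons (signPow c a * y₀) x) (Fin.cons y₀ y) =
      cornerFactor a c x y₀ y * partitionDW n a x y := by
  have hy₀ : y₀ ≠ 0 := by simpa using hg.right_ne 0
  cases c
  · exact partitionDW_corner_top ha x y hy₀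
  · have hg' := hg.cons_left ha true
    rw [← partitionDW_perm_left ha _ _ hg'.left_ne hg.right_ne hg'.left (finRotate (n + 1))]
    rw [show ((Fin.cons (signPow true a * y₀) x : Fin (n + 1) → F) ∘ finRotate (n + 1)) =
      Fin.snoc x (signPow true a * y₀) from (Fin.snoc_eq_cons_rotate ..).symm,
      partitionDW_eq_wallRows, wallRows_snoc]
    refine (corner_entry_bottom ha _ ?_ _).trans ?_
    · simp [hy₀]
    · rw [firstBlock_wallRows, Matrix.smul_apply, partitionDW_eq_wallRows, cornerFactor]
      simp only [Fin.cons_succ, smul_eq_mul]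
      ring

theorem isLaurent_partitionDW {S : Set F} (hS : ∀ t ∈ S, t ≠ 0) (a : F) {n : ℕ} (x : Fin n → F)
    (y : Fin (n + 1) → F) :
    IsLaurent S n fun t => partitionDW (n + 1) a (Fin.cons t x) y := by
  simp only [partitionDW_eq_wallRows, wallRows_cons, wallEntry, Matrix.mul_apply]
  exact IsLaurent.sum _ fun g _ =>
    (isLaurent_lineOp_of_ne hS a y (by simp) _ _).mul_const _

/-! ### The second factor as a determinant -/

theorem factorDet_generic_corner {n : ℕ} {a : F} (ha : a ≠ 0) (c : Bool) (x y : Fin n → F) (y₀ : F)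
    (hg : Generic a x (Fin.cons y₀ y : Fin (n + 1) → F)) :
    factorDet a (Fin.cons (signPow c a * y₀) x : Fin (n + 1) → F) (Fin.cons y₀ y) =
      cornerFactor a c x y₀ y * factorDet a x y := by
  have hg' := hg.cons_left ha c
  refine factorDet_corner ha c x y y₀ (by simpa using hg.right_ne 0) hg.left_ne
    hg.of_cons_right.right_ne (fun i => ?_) fun j => ?_
  · simpa using (hg'.left 0 i.succ (Fin.succ_ne_zero i).symm).sq_ne
  · simpa using (hg.right 0 j.succ (Fin.succ_ne_zero j).symm).sq_ne

theorem Generic.sq_injective {a : F} {m n : ℕ} {x : Fin m → F} {y : Fin n → F}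
    (h : Generic a x y) : Function.Injective fun i => x i ^ 2 := fun i j hij => by
  by_contra hne
  exact (h.left i j hne).sq_ne hij

/-- Values of the new parameter different from the old ones. -/
def newPoints {m : ℕ} (x : Fin m → F) : Set F := {t | t ≠ 0 ∧ ∀ i, t ^ 2 ≠ x i ^ 2}

theorem isLaurent_factorDet_of_generic (a : F) {m n : ℕ} {x : Fin n → F} {z : Fin m → F}
    (h : Generic a x z) (y : Fin (n + 1) → F) :
    IsLaurent (newPoints x) (n + 1) fun t => factorDet a (Fin.cons t x : Fin (n + 1) → F) y :=
  isLaurent_factorDet a x y h.left_ne h.sq_injective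

theorem Generic.mem_newPoints {a t : F} {m n : ℕ} {x : Fin m → F} {y : Fin n → F}
    (h : Generic a (Fin.cons t x : Fin (m + 1) → F) y) : t ∈ newPoints x := by
  refine ⟨by simpa using h.left_ne 0, fun i => ?_⟩
  simpa using (h.left 0 i.succ (Fin.succ_ne_zero i).symm).sq_ne

theorem Generic.signPow_mem_newPoints {a : F} (ha : a ≠ 0) {m n : ℕ} {x : Fin m → F} {y : Fin n → F}
    (h : Generic a x y) (c : Bool) (j : Fin n) : signPow c a * y j ∈ newPoints x :=
  ⟨mul_ne_zero (signPow_ne_zero c ha) (h.right_ne j),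
    fun i => (((h.cross i j).symm ha).signPow_mul_left ha c).sq_ne⟩

/-! ### Symmetry in the column parameters -/

/-- Pairs of operators given by the same noncommutative polynomial in the transfer matrices of rows
for the column parameters `y` and `y'`. -/
def rowPolynomials (a : F) {n : ℕ} (y y' : Fin n → F) :
    Subalgebra F (Matrix (Fin n → Bool) (Fin n → Bool) F × Matrix (Fin n → Bool) (Fin n → Bool) F) :=
  Algebra.adjoin F {p | ∃ x r, x ≠ 0 ∧ p = (rowOp a y x r, rowOp a y' x r)}

theorem rowOp_mem_rowPolynomials (a : F) {n : ℕ} (y y' : Fin n → F) {x : F} (hx : x ≠ 0) (r : Bool) :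
    (rowOp a y x r, rowOp a y' x r) ∈ rowPolynomials a y y' :=
  Algebra.subset_adjoin ⟨x, r, hx, rfl⟩

/-- By linearity it suffices to treat words in the row operators. The wall entry of a word is a grid
partition function with some right boundary, and `gridSum_perm` applies. Nested arcs are thereby
symmetric in y, whatever y-independent weights join their right ends. -/
theorem wallEntry_eq_of_mem_rowPolynomials {a : F} (ha : a ≠ 0) {n : ℕ} {y : Fin n → F}
    (hy : ∀ j, y j ≠ 0) (hyy : ∀ i j, i ≠ j → ScaleIndep a (y i) (y j)) (π : Equiv.Perm (Fin n))
    {A B : Matrix (Fin n → Bool) (Fin n → Bool) F} (h : (A, B) ∈ rowPolynomials a y (y ∘ π)) :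
    wallEntry B = wallEntry A := by
  have key : ∀ p ∈ rowPolynomials a y (y ∘ π), wallEntry p.2 = wallEntry p.1 := by
    intro p hp
    rw [rowPolynomials, ← Subalgebra.mem_toSubmodule, Algebra.adjoin_eq_span] at hp
    induction hp using Submodule.span_induction with
    | zero => rfl
    | add p q _ _ hp hq => simp [wallEntry, Matrix.add_apply] at hp hq ⊢; rw [hp, hq]
    | smul c p _ hp => simp [wallEntry, Matrix.smul_apply] at hp ⊢; rw [hp]; simp
    | mem p hp =>
      have : ∃ w : List (F × Bool), (∀ q ∈ w, q.1 ≠ 0) ∧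
          p = ((w.map fun q => rowOp a y q.1 q.2).prod,
            (w.map fun q => rowOp a (y ∘ π) q.1 q.2).prod) := by
        induction hp using Submonoid.closure_induction with
        | one => exact ⟨[], by simp, rfl⟩
        | mem p hp =>
          obtain ⟨x, r, hx, rfl⟩ := hp
          exact ⟨[(x, r)], by simpa using hx, by simp⟩
        | mul p q _ _ hp hq =>
          obtain ⟨w, hw, rfl⟩ := hp
          obtain ⟨w', hw', rfl⟩ := hq
          refine ⟨w ++ w', fun q hq => ?_, by simp⟩
          rcases List.mem_append.1 hq with h | h
          exacts [hw q h, hw' q h]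
      obtain ⟨w, hw, rfl⟩ := this
      have e : ∀ y : Fin n → F, wallEntry (w.map fun q => rowOp a y q.1 q.2).prod =
          gridSum a (fun (i : Fin w.length) j => w[i].1 * (y j)⁻¹) (fun _ => true)
            (fun i => w[i].2) (fun _ => true) (fun _ => false) := by
        intro y
        rw [gridSum_eq_rows]
        congr 2
        conv_lhs => rw [← List.ofFn_getElem (xs := w), List.map_ofFn]
        rfl
      rw [e, e]
      exact gridSum_perm ha _ y (fun i => hw _ (List.getElem_mem _)) hy
        (fun i j hij => (hyy i j hij).sigma_ne_zero ha (hy i) (hy j)) _ _ π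
  exact key _ h

/-! ### Nested arcs -/

/-- The operator of a system of nested arcs with parameters `x` around the operator `S`. -/
def nestOp (a : F) {n : ℕ} (y : Fin n → F) (S : Matrix (Fin n → Bool) (Fin n → Bool) F) :
    ∀ {m : ℕ}, (Fin m → F) → Matrix (Fin n → Bool) (Fin n → Bool) F
  | 0, _ => S
  | _ + 1, x => ∑ b, rowOp a y (x 0) b * nestOp a y S (Fin.tail x) * rowOp a y (x 0) (!b)

/-- The operators of a system of nested arcs with parameters `x` crossed by a half-column with
parameter `w` which starts inside; the last argument is the state of its end. -/
def crossedOp (a : F) {n : ℕ} (y : Fin n → F) (w : F)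
    (S : Bool → Matrix (Fin n → Bool) (Fin n → Bool) F) :
    ∀ {m : ℕ}, (Fin m → F) → Bool → Matrix (Fin n → Bool) (Fin n → Bool) F
  | 0, _, c => S c
  | _ + 1, x, e => ∑ b, ∑ s, ∑ c, vertexWeight a (x 0 * w⁻¹) s (!b) e c •
      (rowOp a y (x 0) b * crossedOp a y w S (Fin.tail x) c * rowOp a y (x 0) s)

section

variable {a : F} {n : ℕ}

theorem nestOp_cons (y : Fin n → F) (S : Matrix (Fin n → Bool) (Fin n → Bool) F) {m : ℕ} (t : F)
    (x : Fin m → F) : nestOp a y S (Fin.cons t x : Fin (m + 1) → F) =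
      ∑ b, rowOp a y t b * nestOp a y S x * rowOp a y t (!b) := by
  simp only [nestOp, Fin.cons_zero, Fin.tail_cons]

theorem crossedOp_cons (y : Fin n → F) (w : F) (S : Bool → Matrix (Fin n → Bool) (Fin n → Bool) F)
    {m : ℕ} (t : F) (x : Fin m → F) (e : Bool) :
    crossedOp a y w S (Fin.cons t x : Fin (m + 1) → F) e =
      ∑ b, ∑ s, ∑ c, vertexWeight a (t * w⁻¹) s (!b) e c •
        (rowOp a y t b * crossedOp a y w S x c * rowOp a y t s) := by
  simp only [crossedOp, Fin.cons_zero, Fin.tail_cons]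

theorem nestOp_mem_rowPolynomials {y y' : Fin n → F}
    {S S' : Matrix (Fin n → Bool) (Fin n → Bool) F} (hS : (S, S') ∈ rowPolynomials a y y') {m : ℕ}
    (x : Fin m → F) (hx : ∀ i, x i ≠ 0) :
    (nestOp a y S x, nestOp a y' S' x) ∈ rowPolynomials a y y' := by
  induction m with
  | zero => exact hS
  | succ m ih =>
    have := Subalgebra.sum_mem (rowPolynomials a y y') (t := Finset.univ) (f := fun b =>
      (rowOp a y (x 0) b, rowOp a y' (x 0) b) *
        (nestOp a y S (Fin.tail x), nestOp a y' S' (Fin.tail x)) *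
        (rowOp a y (x 0) (!b), rowOp a y' (x 0) (!b))) fun b _ =>
        mul_mem (mul_mem (rowOp_mem_rowPolynomials a y y' (hx 0) b) (ih _ fun i => hx _))
          (rowOp_mem_rowPolynomials a y y' (hx 0) (!b))
    simpa [nestOp] using this

theorem crossedOp_mem_rowPolynomials {y y' : Fin n → F} (w : F)
    {S S' : Bool → Matrix (Fin n → Bool) (Fin n → Bool) F}
    (hS : ∀ c, (S c, S' c) ∈ rowPolynomials a y y') {m : ℕ} (x : Fin m → F) (hx : ∀ i, x i ≠ 0)
    (e : Bool) : (crossedOp a y w S x e, crossedOp a y' w S' x e) ∈ rowPolynomials a y y' := by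
  induction m generalizing e with
  | zero => exact hS e
  | succ m ih =>
    have := Subalgebra.sum_mem (rowPolynomials a y y') (t := Finset.univ) (f := fun b =>
      ∑ s, ∑ c, vertexWeight a (x 0 * w⁻¹) s (!b) e c • ((rowOp a y (x 0) b, rowOp a y' (x 0) b) *
        (crossedOp a y w S (Fin.tail x) c, crossedOp a y' w S' (Fin.tail x) c) *
        (rowOp a y (x 0) s, rowOp a y' (x 0) s))) fun b _ =>
        Subalgebra.sum_mem _ fun s _ => Subalgebra.sum_mem _ fun c _ => Subalgebra.smul_mem _
        (mul_mem (mul_mem (rowOp_mem_rowPolynomials a y y' (hx 0) b) (ih _ (fun i => hx _) c))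
          (rowOp_mem_rowPolynomials a y y' (hx 0) s)) _
    simpa [crossedOp, Prod.fst_sum, Prod.snd_sum] using this

theorem isFirstTriangular_nestOp (y : Fin (n + 1) → F)
    {S : Matrix (Fin (n + 1) → Bool) (Fin (n + 1) → Bool) F} (hS : IsFirstTriangular S) {m : ℕ}
    (x : Fin m → F) : IsFirstTriangular (nestOp a y S x) := by
  induction m with
  | zero => exact hS
  | succ m ih =>
    exact IsFirstTriangular.sum _ fun b =>
      ((isFirstTriangular_lineOp a _ _).mul (ih _)).mul (isFirstTriangular_lineOp a _ _)

theorem isFirstTriangular_crossedOp (y : Fin (n + 1) → F) (w : F)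
    {S : Bool → Matrix (Fin (n + 1) → Bool) (Fin (n + 1) → Bool) F}
    (hS : ∀ c, IsFirstTriangular (S c)) {m : ℕ} (x : Fin m → F) (e : Bool) :
    IsFirstTriangular (crossedOp a y w S x e) := by
  induction m generalizing e with
  | zero => exact hS e
  | succ m ih =>
    exact IsFirstTriangular.sum _ fun b => IsFirstTriangular.sum _ fun s =>
      IsFirstTriangular.sum _ fun c =>
      (((isFirstTriangular_lineOp a _ _).mul (ih _ _)).mul (isFirstTriangular_lineOp a _ _)).smul _

/-- Each arc crosses the frozen column twice, in the same straight way; hence the square. -/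
theorem firstBlock_nestOp (c : Bool) (y₀ : F) (y : Fin n → F)
    {S : Matrix (Fin (n + 1) → Bool) (Fin (n + 1) → Bool) F} (hS : IsFirstTriangular S) {m : ℕ}
    (x : Fin m → F) :
    firstBlock c (nestOp a (Fin.cons y₀ y : Fin (n + 1) → F) S x) =
      (∏ i, sigma (a * signPow c (x i * y₀⁻¹))) ^ 2 • nestOp a y (firstBlock c S) x := by
  induction m with
  | zero => simp [nestOp]
  | succ m ih =>
    simp only [nestOp, firstBlock_sum, Finset.smul_sum, Fin.prod_univ_succ]
    refine Finset.sum_congr rfl fun b _ => ?_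
    have h1 := isFirstTriangular_lineOp a (fun j => x 0 * ((Fin.cons y₀ y : Fin (n + 1) → F) j)⁻¹)
    have h2 := isFirstTriangular_nestOp (a := a) (Fin.cons y₀ y : Fin (n + 1) → F) hS (Fin.tail x)
    rw [firstBlock_mul c ((h1 _).mul h2) (h1 _), firstBlock_mul c (h1 _) h2, firstBlock_rowOp,
      firstBlock_rowOp, ih]
    simp only [smul_mul_assoc, mul_smul_comm, smul_smul]
    congr 1
    simp only [Fin.tail]
    ring

theorem firstBlock_crossedOp (c : Bool) (y₀ : F) (y : Fin n → F) (w : F)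
    {S : Bool → Matrix (Fin (n + 1) → Bool) (Fin (n + 1) → Bool) F}
    (hS : ∀ c, IsFirstTriangular (S c)) {m : ℕ} (x : Fin m → F) (e : Bool) :
    firstBlock c (crossedOp a (Fin.cons y₀ y : Fin (n + 1) → F) w S x e) =
      (∏ i, sigma (a * signPow c (x i * y₀⁻¹))) ^ 2 •
        crossedOp a y w (fun d => firstBlock c (S d)) x e := by
  induction m generalizing e with
  | zero => simp [crossedOp]
  | succ m ih =>
    simp only [crossedOp, firstBlock_sum, Finset.smul_sum, Fin.prod_univ_succ]
    refine Finset.sum_congr rfl fun b _ => Finset.sum_congr rfl fun s _ =>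
      Finset.sum_congr rfl fun d _ => ?_
    have h1 := isFirstTriangular_lineOp a (fun j => x 0 * ((Fin.cons y₀ y : Fin (n + 1) → F) j)⁻¹)
    have h2 := isFirstTriangular_crossedOp (a := a) (Fin.cons y₀ y : Fin (n + 1) → F) w hS
      (Fin.tail x) d
    rw [firstBlock_smul, firstBlock_mul c ((h1 _).mul h2) (h1 _), firstBlock_mul c (h1 _) h2,
      firstBlock_rowOp, firstBlock_rowOp, ih]
    simp only [smul_mul_assoc, mul_smul_comm, smul_smul]
    congr 1
    simp only [Fin.tail]
    ring

theorem wallEntry_smul (q : F) (M : Matrix (Fin n → Bool) (Fin n → Bool) F) :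
    wallEntry (q • M) = q * wallEntry M := rfl

theorem wallEntry_sum {κ : Type*} (s : Finset κ) (M : κ → Matrix (Fin n → Bool) (Fin n → Bool) F) :
    wallEntry (∑ i ∈ s, M i) = ∑ i ∈ s, wallEntry (M i) :=
  Matrix.sum_apply _ _ _ _

/-- The frozen corner selects one orientation of the outermost arc and fixes the first column, and
both lines drop out. Each meets every other line twice, so the domain wall factor appears squared.
-/
theorem nestOp_corner (ha : a ≠ 0) (c : Bool) {y₀ : F} (hy₀ : y₀ ≠ 0) (y : Fin n → F)
    {S : Matrix (Fin (n + 1) → Bool) (Fin (n + 1) → Bool) F} (hS : IsFirstTriangular S) {m : ℕ}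
    (x : Fin m → F) :
    wallEntry (nestOp a (Fin.cons y₀ y : Fin (n + 1) → F) S
      (Fin.cons (signPow c a * y₀) x : Fin (m + 1) → F)) =
      cornerFactor a c x y₀ y ^ 2 * wallEntry (nestOp a y (firstBlock c S) x) := by
  rw [nestOp_cons, wallEntry_sum]
  have h := fun b => corner_entry ha c
    (fun j => signPow c a * y₀ * ((Fin.cons y₀ y : Fin (n + 1) → F) j)⁻¹) (by simp [hy₀])
    (nestOp a (Fin.cons y₀ y : Fin (n + 1) → F) S x) b (!b) (by cases b <;> simp)
  rw [Finset.sum_congr rfl fun b _ => h b, Finset.sum_eq_single c]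
  · rw [if_pos ⟨rfl, rfl⟩, firstBlock_nestOp c y₀ y hS, Matrix.smul_apply, cornerFactor]
    simp only [Fin.cons_succ, smul_eq_mul]
    ring
  · intro b _ hb
    simp [hb]
  · simp

/-- As for `nestOp_corner`; the frozen arc in addition passes straight through its vertex on the
half-column, which gives the extra σ. -/
theorem crossedOp_corner (ha : a ≠ 0) (c : Bool) {y₀ : F} (hy₀ : y₀ ≠ 0) (y : Fin n → F) (w : F)
    {S : Bool → Matrix (Fin (n + 1) → Bool) (Fin (n + 1) → Bool) F}
    (hS : ∀ c, IsFirstTriangular (S c)) {m : ℕ} (x : Fin m → F) :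
    wallEntry (crossedOp a (Fin.cons y₀ y : Fin (n + 1) → F) w S
      (Fin.cons (signPow c a * y₀) x : Fin (m + 1) → F) false) =
      sigma (a * signPow c (signPow c a * y₀ * w⁻¹)) * cornerFactor a c x y₀ y ^ 2 *
        wallEntry (crossedOp a y w (fun d => firstBlock c (S d)) x false) := by
  rw [crossedOp_cons]
  simp only [wallEntry_sum, wallEntry_smul]
  have h := fun d => corner_entry ha c
    (fun j => signPow c a * y₀ * ((Fin.cons y₀ y : Fin (n + 1) → F) j)⁻¹) (by simp [hy₀])
    (crossedOp a (Fin.cons y₀ y : Fin (n + 1) → F) w S x d)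
  have e : ∀ b s d, vertexWeight a (signPow c a * y₀ * w⁻¹) s (!b) false d *
      wallEntry (rowOp a (Fin.cons y₀ y : Fin (n + 1) → F) (signPow c a * y₀) b *
        crossedOp a (Fin.cons y₀ y : Fin (n + 1) → F) w S x d *
        rowOp a (Fin.cons y₀ y : Fin (n + 1) → F) (signPow c a * y₀) s) =
      if b = c ∧ s = (!c) ∧ d = false then sigma (a * signPow c (signPow c a * y₀ * w⁻¹)) *
        cornerFactor a c x y₀ y ^ 2 *
        wallEntry (crossedOp a y w (fun d => firstBlock c (S d)) x false) else 0 := by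
    intro b s d
    by_cases hbs : b = true ∨ s = true
    · have := h d b s hbs
      rw [wallEntry, this, firstBlock_crossedOp c y₀ y w hS, Matrix.smul_apply, cornerFactor]
      simp only [Fin.cons_succ, smul_eq_mul]
      cases b <;> cases s <;> cases c <;> cases d <;> simp [vertexWeight, IceRule] <;> ring
    -- This case escapes `corner_entry`, but three edges would leave the vertex on the half-column,
    -- so its weight is 0.
    · obtain ⟨rfl, rfl⟩ : b = false ∧ s = false := by simpa using hbs
      cases c <;> cases d <;> simp [vertexWeight, IceRule]
  simp only [e, Fintype.sum_bool]
  cases c <;> simp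

/-- Of the two rows of the outermost arc exactly one is reversed, so the degree is n + (n + 1). -/
theorem isLaurent_nestOp {T : Set F} (hT : ∀ t ∈ T, t ≠ 0) (y : Fin (n + 1) → F)
    (S : Matrix (Fin (n + 1) → Bool) (Fin (n + 1) → Bool) F) {m : ℕ} (x : Fin m → F) :
    IsLaurent T (2 * n + 1) fun t => wallEntry (nestOp a y S (Fin.cons t x : Fin (m + 1) → F)) := by
  simp only [nestOp_cons, wallEntry_sum]
  refine IsLaurent.sum _ fun b _ => ?_
  simp only [wallEntry, Matrix.mul_apply]
  refine IsLaurent.sum _ fun g _ => ?_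
  have key : ∀ h : Fin (n + 1) → Bool, IsLaurent T (2 * n + 1) fun t =>
      rowOp a y t b (fun _ => true) h * rowOp a y t (!b) g (fun _ => false) := by
    intro h
    cases b
    · exact ((isLaurent_lineOp_of_ne hT a y (by simp) _ _).mul
        (isLaurent_lineOp hT a y true _ _)).of_eq (by ring)
    · exact ((isLaurent_lineOp hT a y true _ _).mul
        (isLaurent_lineOp_of_ne hT a y (by simp) _ _)).of_eq (by ring)
  simp only [Finset.sum_mul]
  refine IsLaurent.sum _ fun h _ => ((key h).mul_const (nestOp a y S x h g)).congr fun t _ => ?_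
  ring

/-- Either the vertex on the half-column is straight, of degree 1, and exactly one row is reversed,
or that vertex is a turn of constant weight and neither row is reversed. Both rows reversed would
violate the ice rule. -/
theorem isLaurent_crossedOp {T : Set F} (hT : ∀ t ∈ T, t ≠ 0) (y : Fin (n + 1) → F) (w : F)
    (S : Bool → Matrix (Fin (n + 1) → Bool) (Fin (n + 1) → Bool) F) {m : ℕ} (x : Fin m → F) :
    IsLaurent T (2 * n + 2) fun t =>
      wallEntry (crossedOp a y w S (Fin.cons t x : Fin (m + 1) → F) false) := by
  simp only [crossedOp_cons, wallEntry_sum, wallEntry_smul]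
  refine IsLaurent.sum _ fun b _ => IsLaurent.sum _ fun s _ => IsLaurent.sum _ fun c _ => ?_
  simp only [wallEntry, Matrix.mul_apply, Finset.mul_sum]
  refine IsLaurent.sum _ fun g _ => ?_
  have key : ∀ h : Fin (n + 1) → Bool, IsLaurent T (2 * n + 2) fun t =>
      vertexWeight a (t * w⁻¹) s (!b) false c *
        (rowOp a y t b (fun _ => true) h * rowOp a y t s g (fun _ => false)) := by
    intro h
    cases b
    · cases s
      · refine (IsLaurent.zero (S := T)).congr fun t _ => ?_
        cases c <;> simp [vertexWeight, IceRule]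
      · exact ((isLaurent_vertexWeight hT a w true false c).mul
          ((isLaurent_lineOp_of_ne hT a y (by simp) _ _).mul
          (isLaurent_lineOp hT a y true _ _))).of_eq (by ring)
    · cases s
      · exact ((isLaurent_vertexWeight hT a w false false c).mul
          ((isLaurent_lineOp hT a y true _ _).mul
          (isLaurent_lineOp_of_ne hT a y (by simp) _ _))).of_eq (by ring)
      · exact ((isLaurent_vertexWeight_of_ne a w (by simp) false c).mul
          ((isLaurent_lineOp hT a y true _ _).mul
          (isLaurent_lineOp hT a y true _ _))).of_eq (by ring)
  simp only [Finset.sum_mul, Finset.mul_sum]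
  refine IsLaurent.sum _ fun h _ =>
    ((key h).mul_const (crossedOp a y w S x c h g)).congr fun t _ => ?_
  ring

/-- A row with parameter `a w` is moved inside the arcs by means of their crossings with the
half-column. -/
theorem sum_crossedOp_mul_rowOp (ha : a ≠ 0) (y : Fin n → F) (hy : ∀ j, y j ≠ 0) {w : F} (hw : w ≠ 0)
    (S : Bool → Matrix (Fin n → Bool) (Fin n → Bool) F) {m : ℕ} (x : Fin m → F)
    (hx : ∀ i, x i ≠ 0) :
    ∑ c, crossedOp a y w S x c * rowOp a y (a * w) c =
      (∏ i, sigma (a * (x i * w⁻¹))) • nestOp a y (∑ c, S c * rowOp a y (a * w) c) x := by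
  induction m with
  | zero => simp [crossedOp, nestOp]
  | succ m ih =>
    have hx0 := hx 0
    have ex : ∀ r r', ∑ s, ∑ s', vertexWeight a (x 0 * w⁻¹) s r' s' r •
        (rowOp a y (x 0) s * rowOp a y (a * w) s') =
        sigma (a * (x 0 * w⁻¹)) • (rowOp a y (a * w) r * rowOp a y (x 0) r') := by
      intro r r'
      -- The exchange of the rows x₀ and a w needs the crossing parameter a x₀ / (a w) = x₀ / w,
      -- which is that of the vertex of row x₀ on the half-column. At the left end both rows are
      -- directed to the right, and the crossing is frozen with weight σ(a x₀ / w).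
      refine (lineOp_exchange ha (p := x 0 * w⁻¹) (by simp [hx0, hw])
        (fun j => x 0 * (y j)⁻¹) (fun j => a * w * (y j)⁻¹) (fun j => by simp [hx0, hy j])
        (fun j => ?_) true true r r').trans ?_
      · field_simp
      · simp [vertexWeight, IceRule]
    have ih' := ih (Fin.tail x) fun i => hx _
    rw [Fin.prod_univ_succ, mul_smul]
    simp only [nestOp]
    have step : ∑ c, crossedOp a y w S x c * rowOp a y (a * w) c = ∑ b, ∑ c,
        rowOp a y (x 0) b * crossedOp a y w S (Fin.tail x) c *
          ∑ s, ∑ s', vertexWeight a (x 0 * w⁻¹) s (!b) s' c •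
            (rowOp a y (x 0) s * rowOp a y (a * w) s') := by
      simp only [crossedOp, Fintype.sum_bool, add_mul, mul_add, smul_mul_assoc, mul_smul_comm,
        mul_assoc]
      abel
    rw [step]
    simp only [ex]
    have step2 : ∀ b, ∑ c, rowOp a y (x 0) b * crossedOp a y w S (Fin.tail x) c *
        (sigma (a * (x 0 * w⁻¹)) • (rowOp a y (a * w) c * rowOp a y (x 0) (!b))) =
        sigma (a * (x 0 * w⁻¹)) • (rowOp a y (x 0) b *
          (∑ c, crossedOp a y w S (Fin.tail x) c * rowOp a y (a * w) c) *
          rowOp a y (x 0) (!b)) := by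
      intro b
      simp only [Fintype.sum_bool, add_mul, mul_add, smul_add, mul_smul_comm, mul_assoc]
    rw [Finset.smul_sum, Finset.smul_sum]
    refine Finset.sum_congr rfl fun b _ => ?_
    rw [step2, ih']
    simp only [smul_mul_assoc, mul_smul_comm]
    rfl

/-- At t = a w one of the straight weights on the half-column is σ(1) = 0. In the states that
remain, all of weight σ(a²), the upper row of the outermost arc is frozen and its lower row
continues the half-column. This lower row is then moved inside by `sum_crossedOp_mul_rowOp`, where
it forms an arc with the turning row. -/
theorem crossedOp_at_half_column (ha : a ≠ 0) (y : Fin n → F) (hy : ∀ j, y j ≠ 0) {w : F}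
    (hw : w ≠ 0) (S : Bool → Matrix (Fin n → Bool) (Fin n → Bool) F) {m : ℕ} (x : Fin m → F)
    (hx : ∀ i, x i ≠ 0) :
    wallEntry (crossedOp a y w S (Fin.cons (a * w) x : Fin (m + 1) → F) false) =
      sigma (a ^ 2) * (∏ j, sigma (a * (a * w * (y j)⁻¹))) * (∏ i, sigma (a * (x i * w⁻¹))) *
        wallEntry (nestOp a y (∑ c, S c * rowOp a y (a * w) c) x) := by
  have hv : ∀ b s c, vertexWeight a (a * w * w⁻¹) s (!b) false c =
      if b = true ∧ s = c then sigma (a ^ 2) else 0 := by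
    intro b s c
    rw [mul_inv_cancel_right₀ hw]
    cases b <;> cases s <;> cases c <;> simp [vertexWeight, IceRule, ha, sq]
  have h : crossedOp a y w S (Fin.cons (a * w) x : Fin (m + 1) → F) false =
      sigma (a ^ 2) • (rowOp a y (a * w) true *
        ∑ c, crossedOp a y w S x c * rowOp a y (a * w) c) := by
    rw [crossedOp_cons]
    simp only [hv, Fintype.sum_bool]
    simp [mul_add, mul_assoc]
  rw [h, sum_crossedOp_mul_rowOp ha y hy hw S x hx, wallEntry_smul, wallEntry,
    lineOp_true_top_mul, Matrix.smul_apply, smul_eq_mul]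
  ring

end

/-! ### Interpolation at the frozen corners -/

theorem cons_apply_removeNth_eq_perm {α : Type*} {n : ℕ} (y : Fin (n + 1) → α) (j : Fin (n + 1)) :
    ∃ π : Equiv.Perm (Fin (n + 1)), y ∘ π = Fin.cons (y j) (j.removeNth y) :=
  ⟨j.cycleRange.symm, (Fin.cons_removeNth_eq_comp_cycleRange_symm ..).symm⟩

theorem snoc_comp_perm {α : Type*} {n : ℕ} (y : Fin n → α) (w : α) (π : Equiv.Perm (Fin n)) :
    ∃ ρ : Equiv.Perm (Fin (n + 1)),
      (Fin.snoc (y ∘ π) w : Fin (n + 1) → α) = (Fin.snoc y w : Fin (n + 1) → α) ∘ ρ := by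
  let e : Fin (n + 1) → Fin (n + 1) := Fin.snoc (fun j => (π j).castSucc) (Fin.last n)
  have he : Function.Injective e := by
    intro i j
    refine Fin.lastCases ?_ (fun i => ?_) i <;> refine Fin.lastCases ?_ (fun j => ?_) j
    · simp
    · simp [e, (Fin.castSucc_ne_last _).symm]
    · simp [e, Fin.castSucc_ne_last]
    · simp [e]
  refine ⟨Equiv.ofBijective e (Finite.injective_iff_bijective.1 he), ?_⟩
  ext j
  refine Fin.lastCases ?_ (fun j => ?_) j <;> simp [e]

theorem Generic.comp_perm {a : F} {m n : ℕ} {x : Fin m → F} {y : Fin n → F} (h : Generic a x y)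
    (π : Equiv.Perm (Fin n)) : Generic a x (y ∘ π) :=
  h.comp Function.injective_id π.injective

/-- Functions symmetric in `y` which agree at the points `t = a^{±1} y j` are equal, if their
degree in `t` is sufficiently small. -/
theorem eq_of_eq_on_corners {a : F} (ha : a ≠ 0) (ha4 : a ^ 4 ≠ 1) {m n d : ℕ} {x : Fin m → F}
    {y : Fin (n + 1) → F} {t : F} (h : Generic a (Fin.cons t x : Fin (m + 1) → F) y)
    (hd : d < 2 * (n + 1)) (f g : F → (Fin (n + 1) → F) → F)
    (hf : IsLaurent (newPoints x) d fun s => f s y) (hg : IsLaurent (newPoints x) d fun s => g s y)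
    (hfp : ∀ s, s ≠ 0 → ∀ π : Equiv.Perm (Fin (n + 1)), f s (y ∘ π) = f s y)
    (hgp : ∀ s, s ≠ 0 → ∀ π : Equiv.Perm (Fin (n + 1)), g s (y ∘ π) = g s y)
    (hc : ∀ c y₀ (y' : Fin n → F), Generic a x (Fin.cons y₀ y' : Fin (n + 1) → F) →
      f (signPow c a * y₀) (Fin.cons y₀ y') = g (signPow c a * y₀) (Fin.cons y₀ y')) :
    f t y = g t y := by
  have hx := h.of_cons_left
  have ht := h.mem_newPoints
  refine hf.eq_of_eq_on_points hg (fun i : Bool × Fin (n + 1) => signPow i.1 a * y i.2) ?_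
    (signPow_sq_injective ha ha4 hx) (fun i => hx.signPow_mem_newPoints ha i.1 i.2) ?_ ht ht.1
  · simpa using hd
  · rintro ⟨c, j⟩
    -- Symmetry in y brings the column y j to the front, where its corner with the outermost row can
    -- freeze.
    obtain ⟨π, hπ⟩ := cons_apply_removeNth_eq_perm y j
    have h0 := mul_ne_zero (signPow_ne_zero c ha) (hx.right_ne j)
    have hG := hx.comp_perm π
    rw [hπ] at hG
    simp only
    rw [← hfp _ h0 π, ← hgp _ h0 π, hπ]
    exact hc c _ _ hG

/-- The variant of `eq_of_eq_on_corners` with the additional point `t = a w`. -/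
theorem eq_of_eq_on_corners_and_point {a : F} (ha : a ≠ 0) (ha4 : a ^ 4 ≠ 1) {m n d : ℕ}
    {x : Fin m → F} {y : Fin (n + 1) → F} {t w : F}
    (h : Generic a (Fin.cons t x : Fin (m + 1) → F) (Fin.snoc y w : Fin (n + 2) → F))
    (hd : d < 2 * (n + 1) + 1) (f g : F → (Fin (n + 1) → F) → F)
    (hf : IsLaurent (newPoints x) d fun s => f s y) (hg : IsLaurent (newPoints x) d fun s => g s y)
    (hfp : ∀ s, s ≠ 0 → ∀ π : Equiv.Perm (Fin (n + 1)), f s (y ∘ π) = f s y)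
    (hgp : ∀ s, s ≠ 0 → ∀ π : Equiv.Perm (Fin (n + 1)), g s (y ∘ π) = g s y)
    (hc : ∀ c y₀ (y' : Fin n → F),
      Generic a x (Fin.snoc (Fin.cons y₀ y' : Fin (n + 1) → F) w : Fin (n + 2) → F) →
      f (signPow c a * y₀) (Fin.cons y₀ y') = g (signPow c a * y₀) (Fin.cons y₀ y'))
    (hw : f (a * w) y = g (a * w) y) :
    f t y = g t y := by
  have hx := h.of_cons_left
  have ht := h.mem_newPoints
  -- The points are taken from the list a^{±1}y_j, a^{±1}w: all those with y_j, and `none` for a w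
  -- alone. Distinctness is inherited from the full list.
  let e : Option (Bool × Fin (n + 1)) → Bool × Fin (n + 2) := fun o =>
    o.elim (true, Fin.last _) fun i => (i.1, i.2.castSucc)
  have he : Function.Injective e := by
    rintro (_ | ⟨c, i⟩) (_ | ⟨c', j⟩) hij
    · rfl
    · simp only [e, Option.elim, Prod.mk.injEq] at hij
      exact absurd hij.2.symm (Fin.castSucc_ne_last _)
    · simp only [e, Option.elim, Prod.mk.injEq] at hij
      exact absurd hij.2 (Fin.castSucc_ne_last _)
    · simp only [e, Option.elim, Prod.mk.injEq, Fin.castSucc_inj] at hij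
      rw [hij.1, hij.2]
  refine hf.eq_of_eq_on_points hg
    (fun o => signPow (e o).1 a * (Fin.snoc y w : Fin (n + 2) → F) (e o).2) ?_
    ((signPow_sq_injective ha ha4 hx).comp he) (fun o => hx.signPow_mem_newPoints ha _ _) ?_ ht ht.1
  · simpa using hd
  · rintro (_ | ⟨c, j⟩)
    · simpa [e] using hw
    · obtain ⟨π, hπ⟩ := cons_apply_removeNth_eq_perm y j
      have hy : y j ≠ 0 := by simpa using hx.right_ne j.castSucc
      have h0 := mul_ne_zero (signPow_ne_zero c ha) hy
      obtain ⟨ρ, hρ⟩ := snoc_comp_perm y w π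
      have hG := hx.comp_perm ρ
      rw [← hρ, hπ] at hG
      simp only [e, Option.elim, Fin.snoc_castSucc]
      rw [← hfp _ h0 π, ← hgp _ h0 π, hπ]
      exact hc c _ _ hG

theorem cons_ne_zero {m : ℕ} {x : Fin m → F} {s : F} (hs : s ≠ 0) (hx : ∀ i, x i ≠ 0) (i : Fin (m + 1)) :
    (Fin.cons s x : Fin (m + 1) → F) i ≠ 0 := by
  refine Fin.cases ?_ (fun i => ?_) i
  · simpa
  · simpa using hx i

theorem snoc_ne_zero {m : ℕ} {x : Fin m → F} {s : F} (hs : s ≠ 0) (hx : ∀ i, x i ≠ 0) (i : Fin (m + 1)) :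
    (Fin.snoc x s : Fin (m + 1) → F) i ≠ 0 := by
  refine Fin.lastCases ?_ (fun i => ?_) i
  · simpa
  · simpa using hx i

/-! ### Factorization in even size -/

theorem factorDet_zero (a : F) (x y : Fin 0 → F) : factorDet a x y = 1 := by
  simp [factorDet, sigmaVandermonde]

theorem wallEntry_one (M : Matrix (Fin 0 → Bool) (Fin 0 → Bool) F) (hM : M = 1) :
    wallEntry M = 1 := by
  rw [hM, wallEntry, Matrix.one_apply, if_pos (Subsingleton.elim _ _)]

theorem partitionDW_zero (a : F) (x y : Fin 0 → F) : partitionDW 0 a x y = 1 := by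
  rw [partitionDW_eq_wallRows, wallEntry_one _ (by simp [wallRows])]

/-- The half-turn partition function of even size is divisible by the domain wall one. -/
theorem wallEntry_nestOp_one {a : F} (ha : a ≠ 0) (ha4 : a ^ 4 ≠ 1) {n : ℕ} (x y : Fin n → F)
    (h : Generic a x y) :
    wallEntry (nestOp a y 1 x) = partitionDW n a x y * factorDet a x y := by
  induction n with
  | zero =>
    rw [factorDet_zero, partitionDW_zero, mul_one]
    exact wallEntry_one _ rfl
  | succ n ih =>
    rw [← Fin.cons_self_tail x] at h ⊢
    generalize x 0 = t at h ⊢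
    generalize Fin.tail x = x at h ⊢
    have hx := h.of_cons_left
    -- The degree is n from the domain wall factor plus n + 1 from the determinant, against 2n + 2
    -- corner points.
    refine eq_of_eq_on_corners ha ha4 h (d := 2 * n + 1) (by omega)
      (fun s y => wallEntry (nestOp a y 1 (Fin.cons s x : Fin (n + 1) → F)))
      (fun s y => partitionDW (n + 1) a (Fin.cons s x) y *
        factorDet a (Fin.cons s x : Fin (n + 1) → F) y)
      (isLaurent_nestOp (fun s hs => hs.1) y 1 x)
      (((isLaurent_partitionDW (fun s hs => hs.1) a x y).mul
        (isLaurent_factorDet_of_generic a hx y)).of_eq (by ring))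
      (fun s hs π => ?_) (fun s hs π => ?_) fun c y₀ y' hy => ?_
    · exact wallEntry_eq_of_mem_rowPolynomials ha hx.right_ne hx.right π
        (nestOp_mem_rowPolynomials (one_mem _) _ (cons_ne_zero hs hx.left_ne))
    · rw [partitionDW_perm_right ha _ _ (cons_ne_zero hs hx.left_ne) hx.right_ne hx.right,
        factorDet_perm_right]
    · rw [nestOp_corner ha c (by simpa using hy.right_ne 0) y' isFirstTriangular_one, firstBlock_one,
        ih x y' hy.of_cons_right, partitionDW_corner ha c x y' y₀ hy,
        factorDet_generic_corner ha c x y' y₀ hy]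
      ring

/-! ### Nested arcs whose innermost arc changes its parameter -/

/-- The weights of the two states of a turning point with the ratio of parameters `z`. -/
def turnWeight (e : Bool) (a z : F) (c : Bool) : F :=
  if c = e then sigma (a * z) + sigma (a * z⁻¹) else sigma (a ^ 2)

/-- Two adjacent rows with parameters `u`, `v` joined by an arc, with the weights `κ` of the states of
the arc. -/
def arcOp (a : F) {n : ℕ} (κ : Bool → F) (y : Fin n → F) (u v : F) :
    Matrix (Fin n → Bool) (Fin n → Bool) F :=
  ∑ c, κ c • (rowOp a y u (!c) * rowOp a y v c)

theorem arcOp_mem_rowPolynomials (a : F) {n : ℕ} (κ : Bool → F) (y y' : Fin n → F) {u v : F}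
    (hu : u ≠ 0) (hv : v ≠ 0) : (arcOp a κ y u v, arcOp a κ y' u v) ∈ rowPolynomials a y y' := by
  have := Subalgebra.sum_mem (rowPolynomials a y y') (t := Finset.univ) (f := fun c =>
    κ c • ((rowOp a y u (!c), rowOp a y' u (!c)) * (rowOp a y v c, rowOp a y' v c))) fun c _ =>
      Subalgebra.smul_mem _ (mul_mem (rowOp_mem_rowPolynomials a y y' hu (!c))
        (rowOp_mem_rowPolynomials a y y' hv c)) _
  simpa [arcOp] using this

theorem isFirstTriangular_arcOp (a : F) {n : ℕ} (κ : Bool → F) (y : Fin (n + 1) → F) (u v : F) :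
    IsFirstTriangular (arcOp a κ y u v) :=
  IsFirstTriangular.sum _ fun _ =>
    ((isFirstTriangular_lineOp a _ _).mul (isFirstTriangular_lineOp a _ _)).smul _

theorem firstBlock_arcOp (a : F) {n : ℕ} (c : Bool) (κ : Bool → F) (y₀ : F) (y : Fin n → F)
    (u v : F) : firstBlock c (arcOp a κ (Fin.cons y₀ y : Fin (n + 1) → F) u v) =
      (sigma (a * signPow c (u * y₀⁻¹)) * sigma (a * signPow c (v * y₀⁻¹))) • arcOp a κ y u v := by
  simp only [arcOp, firstBlock_sum, Finset.smul_sum]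
  refine Finset.sum_congr rfl fun b _ => ?_
  rw [firstBlock_smul, firstBlock_mul c (isFirstTriangular_lineOp a _ _)
    (isFirstTriangular_lineOp a _ _), firstBlock_rowOp, firstBlock_rowOp]
  simp only [smul_mul_assoc, mul_smul_comm, smul_smul]
  congr 1
  ring

theorem nestOp_smul (a : F) {n : ℕ} (y : Fin n → F) (q : F)
    (S : Matrix (Fin n → Bool) (Fin n → Bool) F) {m : ℕ} (x : Fin m → F) :
    nestOp a y (q • S) x = q • nestOp a y S x := by
  induction m with
  | zero => rfl
  | succ m ih =>
    simp only [nestOp, ih, Finset.smul_sum, smul_mul_assoc, mul_smul_comm]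

theorem cornerFactor_snoc_left (a : F) {m n : ℕ} (c : Bool) (x : Fin m → F) (u y₀ : F)
    (y : Fin n → F) : cornerFactor a c (Fin.snoc x u : Fin (m + 1) → F) y₀ y =
      cornerFactor a c x y₀ y * sigma (a * signPow c (u * y₀⁻¹)) := by
  rw [cornerFactor, Fin.prod_univ_castSucc, cornerFactor]
  simp only [Fin.snoc_castSucc, Fin.snoc_last]
  ring

theorem cornerFactor_snoc_right (a : F) {m n : ℕ} (c : Bool) (x : Fin m → F) (y₀ : F)
    (y : Fin n → F) (w : F) : cornerFactor a c x y₀ (Fin.snoc y w : Fin (n + 1) → F) =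
      cornerFactor a c x y₀ y * sigma (a * signPow c (signPow c a * y₀ * w⁻¹)) := by
  rw [cornerFactor, Fin.prod_univ_castSucc, cornerFactor]
  simp only [Fin.snoc_castSucc, Fin.snoc_last]
  ring

theorem partitionDW_one (a : F) (x y : Fin 1 → F) : partitionDW 1 a x y = sigma (a ^ 2) := by
  rw [partitionDW_eq_wallRows, wallRows]
  simp [lineOp_succ, lineOp_zero, vertexWeight, IceRule]

theorem factorDet_one (a : F) (x y : Fin 1 → F) :
    factorDet a x y = sigma (a * (x 0 * (y 0)⁻¹)) + sigma (a * (x 0 * (y 0)⁻¹)⁻¹) := by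
  simp [factorDet, sigmaVandermonde, factorMatrix]

/-- The base case that dictates `turnWeight`: the two states of the arc contribute σ(a u / y) and
σ(a y / v), and with z = a u / v the chosen weights make the combination split off σ(a z). -/
theorem wallEntry_arcOp_one {a : F} (ha : a ≠ 0) (e : Bool) {u v : F} (hu : u ≠ 0) (hv : v ≠ 0)
    (y : Fin 1 → F) (hy : y 0 ≠ 0) :
    wallEntry (arcOp a (turnWeight e a (a * u * v⁻¹)) y u v) =
      sigma (a * (a * u * v⁻¹)) * (sigma (a ^ 2) *
        (sigma (a * (cond e v u * (y 0)⁻¹)) + sigma (a * (cond e v u * (y 0)⁻¹)⁻¹))) := by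
  have h1 : wallEntry (rowOp a y u true * rowOp a y v false) =
      sigma (a ^ 2) * sigma (a * (u * (y 0)⁻¹)) := by
    rw [wallEntry, lineOp_true_top_mul]
    simp [lineOp_succ, lineOp_zero, vertexWeight, IceRule, mul_comm]
  have h2 : wallEntry (rowOp a y u false * rowOp a y v true) =
      sigma (a ^ 2) * sigma (a * (v * (y 0)⁻¹)⁻¹) := by
    rw [wallEntry, mul_lineOp_true_bottom]
    simp [lineOp_succ, lineOp_zero, vertexWeight, IceRule, mul_comm]
  rw [arcOp, wallEntry_sum, Fintype.sum_bool, wallEntry_smul, wallEntry_smul, Bool.not_true,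
    Bool.not_false, h1, h2]
  cases e <;> simp only [turnWeight, sigma, cond_true, cond_false, if_true, reduceCtorEq, if_false] <;>
    field_simp <;> ring

theorem newPoints_anti {m m' : ℕ} {x : Fin m → F} {x' : Fin m' → F} (h : ∀ i, ∃ j, x i = x' j) :
    newPoints x' ⊆ newPoints x := fun t ht => ⟨ht.1, fun i => by
  obtain ⟨j, hj⟩ := h i
  rw [hj]
  exact ht.2 j⟩

theorem snoc_cond {α : Type*} {m : ℕ} {x : Fin m → α} {u v : α} (e : Bool) (i : Fin (m + 1)) :
    ∃ j, (Fin.snoc x (cond e u v) : Fin (m + 1) → α) i =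
      (Fin.snoc (Fin.snoc x u : Fin (m + 1) → α) v : Fin (m + 2) → α) j := by
  refine Fin.lastCases ?_ (fun i => ?_) i
  · cases e
    · exact ⟨Fin.last _, by simp⟩
    · exact ⟨(Fin.last _).castSucc, by simp⟩
  · exact ⟨i.castSucc.castSucc, by simp⟩

theorem Generic.snoc_cond {a : F} {m n : ℕ} {x : Fin m → F} {y : Fin n → F} {u v : F}
    (h : Generic a (Fin.snoc (Fin.snoc x u : Fin (m + 1) → F) v : Fin (m + 2) → F) y) (e : Bool) :
    Generic a (Fin.snoc x (cond e u v) : Fin (m + 1) → F) y := by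
  let f : Fin (m + 1) → Fin (m + 2) :=
    Fin.snoc (fun i => i.castSucc.castSucc) (cond e (Fin.last m).castSucc (Fin.last (m + 1)))
  have hf : Function.Injective f := by
    intro i j
    refine Fin.lastCases ?_ (fun i => ?_) i <;> refine Fin.lastCases ?_ (fun j => ?_) j
    · simp
    · cases e <;> simp [f, (Fin.castSucc_ne_last _).symm]
    · cases e <;> simp [f, Fin.castSucc_ne_last]
    · simp [f]
  have := h.comp hf Function.injective_id
  rw [Function.comp_id] at this
  convert this using 1
  ext i
  refine Fin.lastCases ?_ (fun i => ?_) i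
  · cases e <;> simp [f]
  · simp [f]

/-- Nested arcs the innermost of which changes its parameter from `u` to `v`. -/
theorem wallEntry_nestOp_arcOp {a : F} (ha : a ≠ 0) (ha4 : a ^ 4 ≠ 1) (e : Bool) {m : ℕ}
    (x : Fin m → F) (u v : F) (y : Fin (m + 1) → F)
    (h : Generic a (Fin.snoc (Fin.snoc x u : Fin (m + 1) → F) v : Fin (m + 2) → F) y) :
    wallEntry (nestOp a y (arcOp a (turnWeight e a (a * u * v⁻¹)) y u v) x) =
      sigma (a * (a * u * v⁻¹)) * (partitionDW (m + 1) a (Fin.snoc x (cond e u v)) y *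
        factorDet a (Fin.snoc x (cond e v u) : Fin (m + 1) → F) y) := by
  have hu : u ≠ 0 := by simpa using h.left_ne (Fin.last m).castSucc
  have hv : v ≠ 0 := by simpa using h.left_ne (Fin.last (m + 1))
  induction m with
  | zero =>
    rw [nestOp, wallEntry_arcOp_one ha e hu hv y (h.right_ne 0), partitionDW_one, factorDet_one]
    rfl
  | succ m ih =>
    rw [← Fin.cons_self_tail x] at h ⊢
    generalize x 0 = t at h ⊢
    generalize Fin.tail x = x at h ⊢
    rw [← Fin.cons_snoc_eq_snoc_cons, ← Fin.cons_snoc_eq_snoc_cons] at h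
    rw [← Fin.cons_snoc_eq_snoc_cons, ← Fin.cons_snoc_eq_snoc_cons]
    have hx := h.of_cons_left
    have he : ∀ e, cond e v u = cond (!e) u v := by simp
    have hZ := hx.snoc_cond e
    have hF := hx.snoc_cond (!e)
    -- The determinant is Laurent only away from the squares of its own parameters; the common
    -- interpolation set avoids both u and v.
    have hZn : newPoints (Fin.snoc (Fin.snoc x u : Fin (m + 1) → F) v : Fin (m + 2) → F) ⊆
      newPoints (Fin.snoc x (cond (!e) u v) : Fin (m + 1) → F) := newPoints_anti (snoc_cond _)
    rw [he]
    refine eq_of_eq_on_corners ha ha4 h (d := 2 * (m + 1) + 1) (by omega)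
      (fun s y => wallEntry (nestOp a y (arcOp a (turnWeight e a (a * u * v⁻¹)) y u v)
        (Fin.cons s x : Fin (m + 1) → F)))
      (fun s y => sigma (a * (a * u * v⁻¹)) *
        (partitionDW (m + 2) a (Fin.cons s (Fin.snoc x (cond e u v) : Fin (m + 1) → F)) y *
        factorDet a (Fin.cons s (Fin.snoc x (cond (!e) u v) : Fin (m + 1) → F) :
          Fin (m + 2) → F) y))
      (isLaurent_nestOp (fun s hs => hs.1) y _ x)
      (IsLaurent.const_mul (((isLaurent_partitionDW (fun s hs => hs.1) a _ y).mul
        ((isLaurent_factorDet_of_generic a hF y).mono hZn)).of_eq (by ring)) _)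
      (fun s hs π => ?_) (fun s hs π => ?_) fun c y₀ y' hy => ?_
    · exact wallEntry_eq_of_mem_rowPolynomials ha hx.right_ne hx.right π
        (nestOp_mem_rowPolynomials (arcOp_mem_rowPolynomials a _ _ _ hu hv) _
          (cons_ne_zero hs hx.of_snoc_left.of_snoc_left.left_ne))
    · rw [partitionDW_perm_right ha _ _ (cons_ne_zero hs hZ.left_ne) hx.right_ne hx.right,
        factorDet_perm_right]
    · rw [nestOp_corner ha c (by simpa using hy.right_ne 0) y' (isFirstTriangular_arcOp a _ _ _ _),
        firstBlock_arcOp, nestOp_smul, wallEntry_smul, ih x y' hy.of_cons_right,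
        partitionDW_corner ha c _ y' y₀ (hy.snoc_cond e),
        factorDet_generic_corner ha c _ y' y₀ (hy.snoc_cond (!e)), cornerFactor_snoc_left,
        cornerFactor_snoc_left, he]
      -- Of the corner factors for u and v one comes from the domain wall partition function and the
      -- other from the determinant; `firstBlock_arcOp` yields both.
      cases e <;> simp only [cond_true, cond_false, Bool.not_true, Bool.not_false] <;> ring

/-! ### Nested arcs crossed by a half-column -/

theorem Generic.cons_of_snoc_right {a w : F} {m n : ℕ} {x : Fin m → F} {y : Fin n → F}
    (h : Generic a x (Fin.snoc y w : Fin (n + 1) → F)) :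
    Generic a x (Fin.cons w y : Fin (n + 1) → F) := by
  have := h.comp_perm (finRotate (n + 1)).symm
  rw [Fin.snoc_eq_cons_rotate] at this
  simpa [Function.comp_def] using this

theorem crossedOp_smul (a : F) {n : ℕ} (y : Fin n → F) (w q : F)
    (S : Bool → Matrix (Fin n → Bool) (Fin n → Bool) F) {m : ℕ} (x : Fin m → F) (e : Bool) :
    crossedOp a y w (fun c => q • S c) x e = q • crossedOp a y w S x e := by
  induction m generalizing e with
  | zero => rfl
  | succ m ih =>
    simp only [crossedOp, ih, Finset.smul_sum, smul_mul_assoc, mul_smul_comm]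
    refine Finset.sum_congr rfl fun b _ => Finset.sum_congr rfl fun s _ =>
      Finset.sum_congr rfl fun c _ => ?_
    rw [smul_comm]

theorem crossedOp_add (a : F) {n : ℕ} (y : Fin n → F) (w : F)
    (S S' : Bool → Matrix (Fin n → Bool) (Fin n → Bool) F) {m : ℕ} (x : Fin m → F) (e : Bool) :
    crossedOp a y w (fun c => S c + S' c) x e = crossedOp a y w S x e + crossedOp a y w S' x e := by
  induction m generalizing e with
  | zero => rfl
  | succ m ih =>
    simp only [crossedOp, ih, mul_add, add_mul, smul_add, Finset.sum_add_distrib]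

/-- The product of a domain wall partition function and a second factor, exactly one of which
contains the lines `u` and `w`. -/
def turnProduct (a : F) (e : Bool) {m : ℕ} (x : Fin m → F) (u : F) (y : Fin m → F) (w : F) : F :=
  cond e
    (partitionDW (m + 1) a (Fin.snoc x u) (Fin.snoc y w) * factorDet a x y)
    (partitionDW m a x y *
      factorDet a (Fin.snoc x u : Fin (m + 1) → F) (Fin.snoc y w : Fin (m + 1) → F))

theorem turnProduct_perm {a : F} (ha : a ≠ 0) (e : Bool) {l m : ℕ} {x : Fin m → F} {u : F}
    (hx : ∀ i, x i ≠ 0) (hu : u ≠ 0) {z : Fin l → F} {y : Fin m → F} {w : F}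
    (h : Generic a z (Fin.snoc y w : Fin (m + 1) → F)) (π : Equiv.Perm (Fin m)) :
    turnProduct a e x u (y ∘ π) w = turnProduct a e x u y w := by
  obtain ⟨ρ, hρ⟩ := snoc_comp_perm y w π
  have h' := h.of_snoc_right
  cases e <;> simp only [turnProduct, cond_true, cond_false]
  · rw [partitionDW_perm_right ha _ _ hx h'.right_ne h'.right, hρ, factorDet_perm_right]
  · rw [hρ, partitionDW_perm_right ha _ _ (snoc_ne_zero hu hx) h.right_ne h.right,
      factorDet_perm_right]

/-- The factor that contains u and w is one size larger. The degrees are m + (m + 2) or (m + 1) + (m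
+ 1), with the same sum. -/
theorem isLaurent_turnProduct (a : F) (e : Bool) {m n : ℕ} {x : Fin m → F} {u : F} {z : Fin n → F}
    (h : Generic a (Fin.snoc x u : Fin (m + 1) → F) z) (y : Fin (m + 1) → F) (w : F) :
    IsLaurent (newPoints (Fin.snoc x u : Fin (m + 1) → F)) (2 * m + 2) fun s =>
      turnProduct a e (Fin.cons s x) u y w := by
  cases e <;> simp only [turnProduct, cond_true, cond_false, ← Fin.cons_snoc_eq_snoc_cons]
  · exact ((isLaurent_partitionDW (fun s hs => hs.1) a x y).mul
      (isLaurent_factorDet_of_generic a h _)).of_eq (by ring)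
  · have : newPoints (Fin.snoc x u : Fin (m + 1) → F) ⊆ newPoints x :=
      newPoints_anti fun i => ⟨i.castSucc, by simp⟩
    exact ((isLaurent_partitionDW (fun s hs => hs.1) a (Fin.snoc x u : Fin (m + 1) → F) _).mul
      ((isLaurent_factorDet_of_generic a h.of_snoc_left y).mono this)).of_eq (by ring)

theorem turnProduct_corner {a : F} (ha : a ≠ 0) (e c : Bool) {m : ℕ} (x : Fin m → F) (u y₀ : F)
    (y : Fin m → F) (w : F) (h : Generic a (Fin.snoc x u : Fin (m + 1) → F)
      (Fin.snoc (Fin.cons y₀ y : Fin (m + 1) → F) w : Fin (m + 2) → F)) :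
    turnProduct a e (Fin.cons (signPow c a * y₀) x) u (Fin.cons y₀ y) w =
      sigma (a * signPow c (signPow c a * y₀ * w⁻¹)) * sigma (a * signPow c (u * y₀⁻¹)) *
        cornerFactor a c x y₀ y ^ 2 * turnProduct a e x u y w := by
  have h1 := h.of_snoc_left.of_snoc_right
  cases e <;> simp only [turnProduct, cond_true, cond_false, ← Fin.cons_snoc_eq_snoc_cons] <;>
    rw [← Fin.cons_snoc_eq_snoc_cons] at h
  · rw [partitionDW_corner ha c _ _ _ h1, factorDet_generic_corner ha c _ _ _ h,
      cornerFactor_snoc_left, cornerFactor_snoc_right]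
    ring
  · rw [partitionDW_corner ha c _ _ _ h, factorDet_generic_corner ha c _ _ _ h1,
      cornerFactor_snoc_left, cornerFactor_snoc_right]
    ring

/-- At t = a w the lines t and w freeze a corner in the factor that contains w, which keeps the row
u; the other factor keeps the row a w. What remains is the right-hand side of
`wallEntry_nestOp_arcOp` with v = a w, up to its scalar. -/
theorem turnProduct_at_half_column {a : F} (ha : a ≠ 0) (e : Bool) {m : ℕ} (x : Fin m → F) (u : F)
    (y : Fin (m + 1) → F) (w : F) (h : Generic a (Fin.snoc x u : Fin (m + 1) → F)
      (Fin.snoc y w : Fin (m + 2) → F)) :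
    turnProduct a e (Fin.cons (a * w) x) u y w =
      cornerFactor a true x w y * sigma (a * (u * w⁻¹)) *
        (partitionDW (m + 1) a (Fin.snoc x (cond e u (a * w))) y *
          factorDet a (Fin.snoc x (cond e (a * w) u) : Fin (m + 1) → F) y) := by
  have h1 := h.cons_of_snoc_right
  have hw : w ≠ 0 := by simpa using h.right_ne (Fin.last (m + 1))
  have h3 := h.of_snoc_left.cons_of_snoc_right.cons_left ha true
  rw [signPow_true] at h3
  have ey : (Fin.snoc y w : Fin (m + 2) → F) = Fin.cons w y ∘ finRotate (m + 2) :=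
    Fin.snoc_eq_cons_rotate ..
  have ex : (Fin.snoc x (a * w) : Fin (m + 1) → F) = Fin.cons (a * w) x ∘ finRotate (m + 1) :=
    Fin.snoc_eq_cons_rotate ..
  cases e <;> simp only [turnProduct, cond_true, cond_false, ← Fin.cons_snoc_eq_snoc_cons]
  · have := factorDet_generic_corner ha true _ _ _ h1
    rw [signPow_true] at this
    rw [ey, factorDet_perm_right, this, cornerFactor_snoc_left, ex,
      partitionDW_perm_left ha _ _ h3.left_ne h3.right_ne h3.left, signPow_true]
    ring
  · have := partitionDW_corner ha true _ _ _ h1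
    rw [signPow_true] at this
    rw [ey, partitionDW_perm_right ha _ _ (cons_ne_zero (mul_ne_zero ha hw) h.left_ne)
      h1.right_ne h1.right, this, cornerFactor_snoc_left, ex, factorDet_perm_left, signPow_true]
    ring

/-- Nested arcs crossed by a half-column, for two choices of the weights of the turning point. -/
theorem wallEntry_crossedOp {a : F} (ha : a ≠ 0) (ha4 : a ^ 4 ≠ 1) (e : Bool) {m : ℕ}
    (x : Fin m → F) (u : F) (y : Fin m → F) (w : F)
    (h : Generic a (Fin.snoc x u : Fin (m + 1) → F) (Fin.snoc y w : Fin (m + 1) → F)) :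
    wallEntry (crossedOp a y w (fun c => turnWeight e a (u * w⁻¹) c • rowOp a y u (!c)) x false) =
      turnProduct a e x u y w := by
  have hu : u ≠ 0 := by simpa using h.left_ne (Fin.last m)
  have hw : w ≠ 0 := by simpa using h.right_ne (Fin.last m)
  induction m with
  | zero =>
    have h0 : wallEntry (rowOp a y u true) = 1 := by simp [wallEntry, lineOp_zero]
    rw [crossedOp, wallEntry_smul, Bool.not_false, h0, mul_one]
    cases e <;> simp only [turnProduct, cond_true, cond_false, turnWeight, factorDet_zero,
      partitionDW_zero, factorDet_one, one_mul, mul_one, if_true, reduceCtorEq, if_false]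
    · rfl
    · exact (partitionDW_one a _ _).symm
  | succ m ih =>
    rw [← Fin.cons_self_tail x] at h ⊢
    generalize x 0 = t at h ⊢
    generalize Fin.tail x = x at h ⊢
    rw [← Fin.cons_snoc_eq_snoc_cons] at h
    have hx := h.of_cons_left
    have hy := hx.of_snoc_right
    -- Degree 2m + 2 against 2m + 3 points: the corners alone would be one short.
    refine eq_of_eq_on_corners_and_point ha ha4 h (d := 2 * m + 2) (by omega)
      (fun s y => wallEntry (crossedOp a y w (fun c => turnWeight e a (u * w⁻¹) c • rowOp a y u (!c))
        (Fin.cons s x : Fin (m + 1) → F) false))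
      (fun s y => turnProduct a e (Fin.cons s x) u y w)
      (isLaurent_crossedOp (fun s hs => hs.1) y w _ x) (isLaurent_turnProduct a e hx y w)
      (fun s hs π => ?_) (fun s hs π => ?_) (fun c y₀ y' hy' => ?_) ?_
    · refine wallEntry_eq_of_mem_rowPolynomials ha hy.right_ne hy.right π
        (crossedOp_mem_rowPolynomials w (fun c => ?_) _ (cons_ne_zero hs hx.of_snoc_left.left_ne) _)
      exact Subalgebra.smul_mem _ (rowOp_mem_rowPolynomials a y _ hu (!c)) _
    · exact turnProduct_perm ha e (cons_ne_zero hs hx.of_snoc_left.left_ne) hu hx π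
    · have hG : Generic a (Fin.snoc x u : Fin (m + 1) → F) (Fin.snoc y' w : Fin (m + 1) → F) := by
        rw [← Fin.cons_snoc_eq_snoc_cons] at hy'
        exact hy'.of_cons_right
      rw [turnProduct_corner ha e c x u y₀ y' w hy', ← ih x y' hG,
        crossedOp_corner ha c (by simpa using hy'.of_snoc_right.right_ne 0) y' w
          fun d => (isFirstTriangular_lineOp a _ _).smul _]
      have : ∀ d, firstBlock c (turnWeight e a (u * w⁻¹) d •
          rowOp a (Fin.cons y₀ y' : Fin (m + 1) → F) u (!d)) =
          sigma (a * signPow c (u * y₀⁻¹)) • (turnWeight e a (u * w⁻¹) d • rowOp a y' u (!d)) :=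
        fun d => by rw [firstBlock_smul, firstBlock_rowOp, smul_comm]
      simp only [this]
      rw [crossedOp_smul, wallEntry_smul]
      ring
    · have hG := hx.snoc_left ha true
      rw [signPow_true] at hG
      -- The ratio a u / v prescribed for an arc from u to v becomes, at v = a w, the ratio u / w of
      -- the turning point.
      have hz : a * u * (a * w)⁻¹ = u * w⁻¹ := by field_simp
      have := wallEntry_nestOp_arcOp ha ha4 e x u (a * w) y hG
      rw [hz, arcOp] at this
      rw [crossedOp_at_half_column ha y hy.right_ne hw _ x hx.of_snoc_left.left_ne,
        turnProduct_at_half_column ha e x u y w hx]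
      simp only [smul_mul_assoc]
      rw [this, cornerFactor]
      simp only [signPow_true]
      ring

/-- The half-column partition function as a combination of the two products. -/
theorem wallEntry_crossedOp_rowOp {a : F} (ha : a ≠ 0) (ha4 : a ^ 4 ≠ 1) {m : ℕ}
    (x : Fin m → F) (u : F) (y : Fin m → F) (w : F)
    (h : Generic a (Fin.snoc x u : Fin (m + 1) → F) (Fin.snoc y w : Fin (m + 1) → F)) :
    sigma a * (a + a⁻¹ + u * w⁻¹ + w * u⁻¹) *
        wallEntry (crossedOp a y w (fun c => rowOp a y u (!c)) x false) =
      turnProduct a true x u y w + turnProduct a false x u y w := by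
  have hu : u ≠ 0 := by simpa using h.left_ne (Fin.last m)
  have hw : w ≠ 0 := by simpa using h.right_ne (Fin.last m)
  -- The sum σ(az) + σ(a/z) + σ(a²) = σ(a)(a + a⁻¹ + z + z⁻¹) arises on both states, so the two
  -- weightings together are a constant multiple of the unweighted turning point.
  have e : ∀ c, turnWeight true a (u * w⁻¹) c + turnWeight false a (u * w⁻¹) c =
      sigma a * (a + a⁻¹ + u * w⁻¹ + w * u⁻¹) := by
    intro c
    cases c <;> simp only [turnWeight, sigma, if_true, reduceCtorEq, if_false] <;> field_simp <;> ring
  rw [← wallEntry_crossedOp ha ha4 true x u y w h, ← wallEntry_crossedOp ha ha4 false x u y w h,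
    ← wallEntry_smul, ← crossedOp_smul]
  have := crossedOp_add a y w (fun c => turnWeight true a (u * w⁻¹) c • rowOp a y u (!c))
    (fun c => turnWeight false a (u * w⁻¹) c • rowOp a y u (!c)) x false
  simp only [← add_smul, e] at this
  rw [this]
  rfl

/-! ### Identification of the half-turn partition functions with arc operators -/

theorem sum_fin_cons {α M : Type*} [Fintype α] [AddCommMonoid M] {n : ℕ} (f : (Fin (n + 1) → α) → M) :
    ∑ g, f g = ∑ b, ∑ g : Fin n → α, f (Fin.cons b g) := by
  rw [← (Fin.consEquiv fun _ => α).sum_comp, Fintype.sum_prod_type]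
  rfl

theorem sum_fin_snoc {α M : Type*} [Fintype α] [AddCommMonoid M] {n : ℕ} (f : (Fin (n + 1) → α) → M) :
    ∑ g, f g = ∑ b, ∑ g : Fin n → α, f (Fin.snoc g b) := by
  rw [← (Fin.snocEquiv fun _ => α).sum_comp, Fintype.sum_prod_type]
  rfl

theorem ofFn_prod_two_ends {R : Type*} [Monoid R] {n : ℕ} (M : Fin (n + 2) → R) :
    (List.ofFn M).prod =
      M 0 * ((List.ofFn fun i : Fin n => M i.castSucc.succ).prod * M (Fin.last _)) := by
  rw [List.ofFn_succ, List.prod_cons, List.ofFn_succ', List.concat_eq_append, List.prod_append,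
    List.prod_singleton]
  rfl

theorem rowEven_zero (m : ℕ) : rowEven (m + 1) (0 : Fin (2 * m + 2)) = 0 := by
  ext; simp [rowEven]

theorem rowEven_last (m : ℕ) : rowEven (m + 1) (Fin.last (2 * m + 1)) = 0 := by
  ext; simp [rowEven]; omega

theorem rowEven_succ (m : ℕ) (i : Fin (2 * m)) :
    rowEven (m + 1) (i.castSucc.succ : Fin (2 * m + 2)) = (rowEven m i).succ := by
  ext; simp [rowEven]; omega

theorem rowOdd_zero (m : ℕ) : rowOdd (m + 1) (0 : Fin (2 * m + 3)) = 0 := by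
  ext; simp [rowOdd]

theorem rowOdd_last (m : ℕ) : rowOdd (m + 1) (Fin.last (2 * m + 2)) = 0 := by
  ext; simp [rowOdd]; omega

theorem rowOdd_succ (m : ℕ) (i : Fin (2 * m + 1)) :
    rowOdd (m + 1) (i.castSucc.succ : Fin (2 * m + 3)) = (rowOdd m i).succ := by
  ext; simp [rowOdd]; omega

theorem midRow_succ (m : ℕ) :
    midRow (m + 1) = ((midRow m).castSucc.succ : Fin (2 * m + 3)) := rfl

theorem lowRow_castSucc (m : ℕ) (k : Fin m) :
    lowRow (m + 1) k.castSucc = ((lowRow m k).castSucc.succ : Fin (2 * m + 3)) := by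
  ext; simp [lowRow]; omega

theorem lowRow_last (m : ℕ) : lowRow (m + 1) (Fin.last m) = Fin.last (2 * m + 2) := by
  ext; simp [lowRow]; omega

theorem rev_castSucc_succ {n : ℕ} (i : Fin n) :
    (i.castSucc.succ : Fin (n + 2)).rev = i.rev.castSucc.succ := by
  rw [Fin.rev_succ, Fin.rev_castSucc, Fin.succ_castSucc]

theorem antisymm_cons_snoc {n : ℕ} (r : Fin n → Bool) (b s : Bool) :
    (∀ i, (Fin.cons b (Fin.snoc r s : Fin (n + 1) → Bool) : Fin (n + 2) → Bool) i.rev =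
      !(Fin.cons b (Fin.snoc r s : Fin (n + 1) → Bool) : Fin (n + 2) → Bool) i) ↔
      s = (!b) ∧ ∀ i, r i.rev = !r i := by
  have hl : (Fin.last (n + 1)) = (Fin.last n).succ := rfl
  constructor
  · intro h
    refine ⟨?_, fun i => ?_⟩
    · have := h 0
      rwa [Fin.rev_zero, hl, Fin.cons_succ, Fin.snoc_last, Fin.cons_zero] at this
    · have := h i.castSucc.succ
      rwa [rev_castSucc_succ, Fin.cons_succ, Fin.cons_succ, Fin.snoc_castSucc, Fin.snoc_castSucc]
        at this
  · rintro ⟨rfl, h⟩ i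
    refine Fin.cases ?_ (fun i => ?_) i
    · rw [Fin.rev_zero, hl, Fin.cons_succ, Fin.snoc_last, Fin.cons_zero]
    · refine Fin.lastCases ?_ (fun i => ?_) i
      · rw [← hl, Fin.rev_last, hl, Fin.cons_succ, Fin.snoc_last, Fin.cons_zero, Bool.not_not]
      · rw [rev_castSucc_succ, Fin.cons_succ, Fin.cons_succ, Fin.snoc_castSucc, Fin.snoc_castSucc, h]

/-- The outermost arc consists of the first and the last row; removing both preserves the
antisymmetry of the right ends and the numbering of the parameters. -/
theorem nestOp_one_eq_sum (a : F) {n : ℕ} (y : Fin n → F) {m : ℕ} (x : Fin m → F) :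
    nestOp a y 1 x = ∑ r : Fin (2 * m) → Bool, if ∀ i, r i.rev = !r i then
      (List.ofFn fun i => rowOp a y (x (rowEven m i)) (r i)).prod else 0 := by
  induction m with
  | zero =>
    rw [nestOp]
    simp
  | succ m ih =>
    change _ = ∑ r : Fin (2 * m + 2) → Bool, if ∀ i, r i.rev = !r i then
      (List.ofFn fun i : Fin (2 * m + 2) => rowOp a y (x (rowEven (m + 1) i)) (r i)).prod else 0
    rw [sum_fin_cons, nestOp]
    refine Finset.sum_congr rfl fun b _ => ?_
    rw [sum_fin_snoc, Finset.sum_eq_single (!b), ih, Finset.mul_sum, Finset.sum_mul]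
    · refine Finset.sum_congr rfl fun r _ => ?_
      simp only [antisymm_cons_snoc, ofFn_prod_two_ends, rowEven_zero, rowEven_last, rowEven_succ,
        Fin.cons_succ, Fin.snoc_castSucc, Fin.cons_zero, true_and, mul_ite, ite_mul, mul_zero,
        zero_mul]
      refine if_congr Iff.rfl ?_ rfl
      rw [mul_assoc]
      congr 2
      rw [show Fin.last (2 * m + 1) = (Fin.last (2 * m)).succ from rfl, Fin.cons_succ, Fin.snoc_last]
    · intro s _ hs
      refine Finset.sum_eq_zero fun r _ => ?_
      exact if_neg fun h => hs ((antisymm_cons_snoc r b s).1 h).1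
    · simp

theorem partitionHTEven_eq (m : ℕ) (a : F) (x y : Fin m → F) :
    partitionHTEven m a x y = wallEntry (nestOp a y 1 x) := by
  rw [nestOp_one_eq_sum, wallEntry_sum]
  have e : ∀ r : Fin (2 * m) → Bool, wallEntry (if ∀ i, r i.rev = !r i then
      (List.ofFn fun i => rowOp a y (x (rowEven m i)) (r i)).prod else 0) =
      if ∀ i, r i.rev = !r i then gridSum a (fun i j => x (rowEven m i) * (y j)⁻¹) (fun _ => true) r
        (fun _ => true) (fun _ => false) else 0 := by
    intro r
    rw [gridSum_eq_rows]
    split_ifs <;> rfl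
  have e' : ∀ r : Fin (2 * m) → Bool, (if ∀ i, r i.rev = !r i then
      gridSum a (fun i j => x (rowEven m i) * (y j)⁻¹) (fun _ => true) r
        (fun _ => true) (fun _ => false) else 0) =
      ∑ h : Fin (2 * m) → Fin (m + 1) → Bool, ∑ v : Fin (2 * m + 1) → Fin m → Bool,
        if IsHalfTurnEven m h v ∧ r = fun i => h i (Fin.last m) then
          ∏ i : Fin (2 * m), ∏ j : Fin m, vertexWeight a (x (rowEven m i) * (y j)⁻¹)
            (h i j.castSucc) (h i j.succ) (v i.succ j) (v i.castSucc j) else 0 := by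
    intro r
    have hiff : ∀ (h : Fin (2 * m) → Fin (m + 1) → Bool) (v : Fin (2 * m + 1) → Fin m → Bool),
        (IsHalfTurnEven m h v ∧ r = fun i => h i (Fin.last m)) ↔ (∀ i, r i.rev = !r i) ∧
          (∀ i, h i 0 = true ∧ h i (Fin.last m) = r i) ∧
            ∀ j, v 0 j = true ∧ v (Fin.last (2 * m)) j = false := by
      intro h v
      constructor
      · rintro ⟨⟨h1, h2, h3⟩, rfl⟩
        exact ⟨h2, fun i => ⟨h1 i, rfl⟩, h3⟩
      · rintro ⟨h2, h1, h3⟩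
        obtain rfl : r = fun i => h i (Fin.last m) := funext fun i => (h1 i).2.symm
        exact ⟨⟨fun i => (h1 i).1, h2, h3⟩, rfl⟩
    simp only [hiff, gridSum]
    split_ifs with hr
    · simp [hr]
    · simp [hr]
  simp only [e, e']
  rw [Finset.sum_comm, partitionHTEven]
  refine Finset.sum_congr rfl fun h _ => ?_
  rw [Finset.sum_comm]
  refine Finset.sum_congr rfl fun v _ => ?_
  simp only [ite_and]
  split_ifs <;> simp

/-- Removing the outermost arc removes the first row, the last row and the lowest vertex of the
half-column. The induction therefore runs over the state `e` of the lower end. -/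
theorem crossedOp_rowOp_eq_sum (a : F) {n : ℕ} (y : Fin n → F) (u w₀ : F) {m : ℕ} (x : Fin m → F)
    (e : Bool) :
    crossedOp a y w₀ (fun c => rowOp a y u (!c)) x e =
      ∑ r : Fin (2 * m + 1) → Bool, ∑ w : Fin (m + 1) → Bool,
        if w 0 = (!r (midRow m)) ∧ w (Fin.last m) = e then
          (∏ k : Fin m, vertexWeight a
            ((Fin.snoc x u : Fin (m + 1) → F) (rowOdd m (lowRow m k)) * w₀⁻¹)
            (r (lowRow m k)) (!r (lowRow m k).rev) (w k.succ) (w k.castSucc)) •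
          (List.ofFn fun i => rowOp a y ((Fin.snoc x u : Fin (m + 1) → F) (rowOdd m i)) (r i)).prod
        else 0 := by
  induction m generalizing e with
  | zero =>
    rw [crossedOp, sum_fin_cons]
    simp only [sum_fin_cons]
    have h1 : midRow 0 = (0 : Fin (0 + 1)) := rfl
    have h2 : (Fin.snoc x u : Fin (0 + 1) → F) 0 = u := Fin.snoc_last ..
    have h3 : rowOdd 0 (0 : Fin (0 + 1)) = 0 := rfl
    cases e <;> simp [h1, h2, h3, Fin.last]
  | succ m ih =>
    rw [← Fin.cons_self_tail x, crossedOp_cons]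
    generalize x 0 = t
    generalize Fin.tail x = x
    change _ = ∑ r : Fin (2 * m + 1 + 2) → Bool, ∑ w : Fin (m + 2) → Bool,
        if w 0 = (!r (midRow (m + 1))) ∧ w (Fin.last (m + 1)) = e then
          (∏ k : Fin (m + 1), vertexWeight a
            ((Fin.snoc (Fin.cons t x : Fin (m + 1) → F) u : Fin (m + 2) → F)
              (rowOdd (m + 1) (lowRow (m + 1) k)) * w₀⁻¹)
            (r (lowRow (m + 1) k)) (!r (lowRow (m + 1) k).rev) (w k.succ) (w k.castSucc)) •
          (List.ofFn fun i : Fin (2 * m + 1 + 2) => rowOp a y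
            ((Fin.snoc (Fin.cons t x : Fin (m + 1) → F) u : Fin (m + 2) → F)
              (rowOdd (m + 1) i)) (r i)).prod
        else 0
    rw [sum_fin_cons]
    refine Finset.sum_congr rfl fun b _ => ?_
    rw [sum_fin_snoc]
    refine Finset.sum_congr rfl fun s _ => ?_
    simp only [ih, Finset.mul_sum, Finset.sum_mul, Finset.smul_sum]
    rw [Finset.sum_comm]
    refine Finset.sum_congr rfl fun r _ => ?_
    -- The last edge of the half-column has to be `e`; the intermediate state in the recursion of
    -- `crossedOp` is the edge just above it.
    rw [Finset.sum_comm, sum_fin_snoc (n := m + 1), Finset.sum_eq_single e]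
    · refine Finset.sum_congr rfl fun w _ => ?_
      rw [Finset.sum_eq_single (w (Fin.last m))]
      · have hs : (Fin.cons b (Fin.snoc r s : Fin (2 * m + 1 + 1) → Bool) : Fin (2 * m + 1 + 2) → Bool)
            (Fin.last (2 * m + 2)) = s := by
          rw [← Fin.succ_last, Fin.cons_succ, Fin.snoc_last]
        have hw : ∀ k : Fin (m + 1), (Fin.snoc w e : Fin (m + 2) → Bool) k.castSucc = w k :=
          fun k => Fin.snoc_castSucc ..
        have hw' : ∀ k : Fin m, (Fin.snoc w e : Fin (m + 2) → Bool) k.castSucc.succ = w k.succ :=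
          fun k => by rw [Fin.succ_castSucc, hw]
        have hw0 : (Fin.snoc w e : Fin (m + 2) → Bool) 0 = w 0 := hw 0
        have hwl : (Fin.snoc w e : Fin (m + 2) → Bool) (Fin.last m).succ = e := Fin.snoc_last ..
        rw [← Fin.cons_snoc_eq_snoc_cons, Fin.prod_univ_castSucc, ofFn_prod_two_ends]
        simp only [hw, hw', hw0, hwl, hs, Fin.snoc_last, midRow_succ, lowRow_castSucc, lowRow_last,
          rowOdd_zero, rowOdd_succ, rowOdd_last, rev_castSucc_succ, Fin.rev_last,
          Fin.cons_zero, Fin.cons_succ, Fin.snoc_castSucc, and_true]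
        split_ifs
        · simp only [smul_mul_assoc, mul_smul_comm, smul_smul, mul_assoc]
          congr 1
          ring
        · simp
      · intro c _ hc
        rw [if_neg fun h => hc h.2.symm]
        simp
      · simp
    · intro c _ hc
      refine Finset.sum_eq_zero fun w _ => ?_
      exact if_neg fun h => hc (by simpa using h.2)
    · simp

theorem partitionHTOdd_eq (m : ℕ) (a : F) (x y : Fin (m + 1) → F) :
    partitionHTOdd m a x y = wallEntry (crossedOp a (fun j => y j.castSucc) (y (Fin.last m))
      (fun c => rowOp a (fun j => y j.castSucc) (x (Fin.last m)) (!c)) (fun i => x i.castSucc) false) := by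
  have hx : (Fin.snoc (fun i => x i.castSucc) (x (Fin.last m)) : Fin (m + 1) → F) = x :=
    Fin.snoc_init_self x
  rw [crossedOp_rowOp_eq_sum, hx, wallEntry_sum]
  simp only [wallEntry_sum]
  let V : (Fin (2 * m + 1) → Bool) → (Fin (m + 1) → Bool) → F := fun r w =>
    ∏ k : Fin m, vertexWeight a (x (rowOdd m (lowRow m k)) * (y (Fin.last m))⁻¹)
      (r (lowRow m k)) (!r (lowRow m k).rev) (w k.succ) (w k.castSucc)
  have e : ∀ (r : Fin (2 * m + 1) → Bool) (w : Fin (m + 1) → Bool),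
      wallEntry (if w 0 = (!r (midRow m)) ∧ w (Fin.last m) = false then
        V r w • (List.ofFn fun i => rowOp a (fun j => y j.castSucc) (x (rowOdd m i)) (r i)).prod
        else 0) =
      ∑ h : Fin (2 * m + 1) → Fin (m + 1) → Bool, ∑ v : Fin (2 * m + 2) → Fin m → Bool,
        if IsHalfTurnOdd m h v w ∧ r = fun i => h i (Fin.last m) then
          (∏ i : Fin (2 * m + 1), ∏ j : Fin m, vertexWeight a (x (rowOdd m i) * (y j.castSucc)⁻¹)
            (h i j.castSucc) (h i j.succ) (v i.succ j) (v i.castSucc j)) *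
            V (fun i => h i (Fin.last m)) w else 0 := by
    intro r w
    have hiff : ∀ (h : Fin (2 * m + 1) → Fin (m + 1) → Bool) (v : Fin (2 * m + 2) → Fin m → Bool),
        (IsHalfTurnOdd m h v w ∧ r = fun i => h i (Fin.last m)) ↔
          (w 0 = (!r (midRow m)) ∧ w (Fin.last m) = false) ∧
          (∀ i, h i 0 = true ∧ h i (Fin.last m) = r i) ∧
            ∀ j, v 0 j = true ∧ v (Fin.last (2 * m + 1)) j = false := by
      intro h v
      constructor
      · rintro ⟨⟨h1, h2, h3⟩, rfl⟩
        exact ⟨h3, fun i => ⟨h1 i, rfl⟩, h2⟩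
      · rintro ⟨h3, h1, h2⟩
        obtain rfl : r = fun i => h i (Fin.last m) := funext fun i => (h1 i).2.symm
        exact ⟨⟨fun i => (h1 i).1, h2, h3⟩, rfl⟩
    by_cases hr : w 0 = (!r (midRow m)) ∧ w (Fin.last m) = false
    · rw [if_pos hr, wallEntry_smul, wallEntry, ← gridSum_eq_rows, gridSum, Finset.mul_sum]
      refine Finset.sum_congr rfl fun h _ => ?_
      rw [Finset.mul_sum]
      refine Finset.sum_congr rfl fun v _ => ?_
      rw [mul_ite, mul_zero]
      refine if_ctx_congr ((and_iff_right hr).symm.trans (hiff h v).symm) (fun hh => ?_) fun _ => rfl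
      rw [hh.2, mul_comm]
    · rw [if_neg hr, wallEntry, Matrix.zero_apply, eq_comm]
      refine Finset.sum_eq_zero fun h _ => Finset.sum_eq_zero fun v _ => ?_
      exact if_neg fun hh => hr ((hiff h v).1 hh).1
  refine Eq.trans ?_ (Finset.sum_congr rfl fun r _ => Finset.sum_congr rfl fun w _ => (e r w).symm)
  rw [partitionHTOdd]
  have c1 : ∀ G : (Fin (m + 1) → Bool) →
      (Fin (2 * m + 1) → Fin (m + 1) → Bool) → (Fin (2 * m + 2) → Fin m → Bool) → F,
      ∑ w, ∑ h, ∑ v, G w h v = ∑ h, ∑ v, ∑ w, G w h v := fun G => by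
    rw [Finset.sum_comm]
    exact Finset.sum_congr rfl fun h _ => Finset.sum_comm
  refine Eq.trans ?_ (Finset.sum_congr rfl fun r _ => (c1 _).symm)
  refine Eq.trans ?_ Finset.sum_comm
  refine Finset.sum_congr rfl fun h _ => ?_
  refine Eq.trans ?_ Finset.sum_comm
  refine Finset.sum_congr rfl fun v _ => ?_
  refine Eq.trans ?_ Finset.sum_comm
  refine Finset.sum_congr rfl fun w _ => ?_
  simp only [ite_and]
  split_ifs <;> simp [V]

/-! ### Nonvanishing of the domain wall partition function -/

section

variable {R : Type*} [CommRing R]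

/-- The weight of a vertex multiplied by the spectral parameters of both lines; here `b` stands
for `a⁻¹`. -/
def polyWeight (a b x y : R) (l r d t : Bool) : R :=
  if IceRule l r d t then
    if l ≠ r then (a ^ 2 - b ^ 2) * (x * y)
    else if l = d then a * x ^ 2 - b * y ^ 2
    else a * y ^ 2 - b * x ^ 2
  else 0

/-- The domain wall partition function with denominators cleared. -/
def polyDW (n : ℕ) (a b : R) (x y : Fin n → R) : R :=
  ∑ h : Fin n → Fin (n + 1) → Bool, ∑ v : Fin (n + 1) → Fin n → Bool,
    if IsDomainWall n h v then
      ∏ i : Fin n, ∏ j : Fin n,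
        polyWeight a b (x i) (y j) (h i j.castSucc) (h i j.succ) (v i.succ j) (v i.castSucc j)
    else 0

theorem map_polyWeight {R' : Type*} [CommRing R'] (φ : R →+* R') (a b x y : R) (l r d t : Bool) :
    φ (polyWeight a b x y l r d t) = polyWeight (φ a) (φ b) (φ x) (φ y) l r d t := by
  simp only [polyWeight]
  split_ifs <;> simp

theorem map_polyDW {R' : Type*} [CommRing R'] (φ : R →+* R') (n : ℕ) (a b : R) (x y : Fin n → R) :
    φ (polyDW n a b x y) = polyDW n (φ a) (φ b) (fun i => φ (x i)) fun j => φ (y j) := by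
  simp only [polyDW, map_sum, apply_ite φ, map_prod, map_polyWeight, map_zero]

end

theorem polyWeight_eq {a x y : F} (ha : a ≠ 0) (hx : x ≠ 0) (hy : y ≠ 0) (l r d t : Bool) :
    polyWeight a a⁻¹ x y l r d t = x * y * vertexWeight a (x * y⁻¹) l r d t := by
  simp only [polyWeight, vertexWeight, sigma]
  split_ifs
  · field_simp
  · field_simp
  · field_simp
  · simp

theorem polyDW_eq {a : F} (ha : a ≠ 0) (n : ℕ) (x y : Fin n → F) (hx : ∀ i, x i ≠ 0)
    (hy : ∀ j, y j ≠ 0) :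
    polyDW n a a⁻¹ x y = (∏ i, ∏ j, x i * y j) * partitionDW n a x y := by
  simp only [polyDW, partitionDW, Finset.mul_sum, mul_ite, mul_zero, polyWeight_eq ha (hx _) (hy _),
    Finset.prod_mul_distrib]

theorem polyDW_eq_zero_iff {a : F} (ha : a ≠ 0) (n : ℕ) (x y : Fin n → F) (hx : ∀ i, x i ≠ 0)
    (hy : ∀ j, y j ≠ 0) : polyDW n a a⁻¹ x y = 0 ↔ partitionDW n a x y = 0 := by
  rw [polyDW_eq ha n x y hx hy, mul_eq_zero, or_iff_right]
  exact Finset.prod_ne_zero_iff.2 fun i _ => Finset.prod_ne_zero_iff.2 fun j _ =>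
    mul_ne_zero (hx i) (hy j)

theorem sigma_sq_ne_zero {a : F} (ha : a ≠ 0) (ha4 : a ^ 4 ≠ 1) : sigma (a ^ 2) ≠ 0 :=
  sigma_ne_zero (pow_ne_zero 2 ha) (by rwa [← pow_mul])

/-- At `x i = a⁻¹ y i` there is a single state. -/
theorem partitionDW_diagonal_ne_zero {n : ℕ} {a : F} (ha : a ≠ 0) (ha4 : a ^ 4 ≠ 1) (y : Fin n → F)
    (hy : ∀ j, y j ≠ 0) (hyy : ∀ i j, i ≠ j → ScaleIndep a (y i) (y j)) :
    partitionDW n a (fun i => a⁻¹ * y i) y ≠ 0 := by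
  induction n with
  | zero =>
    rw [partitionDW_zero]
    exact one_ne_zero
  | succ n ih =>
    have e : (fun i => a⁻¹ * y i) = Fin.cons (a⁻¹ * y 0) fun i => a⁻¹ * Fin.tail y i := by
      ext i
      refine Fin.cases ?_ (fun i => ?_) i <;> simp [Fin.tail]
    rw [e]
    conv_lhs => rw [← Fin.cons_self_tail y]
    rw [Fin.cons_zero, Fin.tail_cons, partitionDW_corner_top ha _ _ (hy 0)]
    refine mul_ne_zero (mul_ne_zero (mul_ne_zero (sigma_sq_ne_zero ha ha4) ?_) ?_)
      (ih _ (fun j => hy _) fun i j hij => hyy _ _ ((Fin.succ_injective n).ne hij))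
    · refine Finset.prod_ne_zero_iff.2 fun j _ => ?_
      have := (hyy j.succ 0 (Fin.succ_ne_zero j)).sigma_ne_zero ha (hy _) (hy _)
      convert this using 3
      simp [Fin.tail]
      ring
    · refine Finset.prod_ne_zero_iff.2 fun j _ => ?_
      have := (hyy 0 j.succ (Fin.succ_ne_zero j).symm).sigma_ne_zero ha (hy _) (hy _)
      convert this using 3
      simp [Fin.tail]
      ring

/-- Because of its denominators Z itself cannot be specialized. The polynomial `polyDW` can, with
`b` in place of a⁻¹: if it vanished, so would its image under ψ, which sends x_i to a⁻¹y_i and gives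
the nonzero diagonal value. -/
theorem partitionDW_ne_zero_of_specialization {R : Type*} [CommRing R] (φ ψ : R →+* F)
    (hφ : Function.Injective φ) {A : F} (hA : A ≠ 0) (hA4 : A ^ 4 ≠ 1) {n : ℕ} {a b : R}
    {x y : Fin n → R} (h1 : φ a = A) (h2 : φ b = A⁻¹) (h3 : ψ a = A) (h4 : ψ b = A⁻¹)
    (hx : ∀ i, φ (x i) ≠ 0) (hy : ∀ i, φ (y i) ≠ 0) (hxy : ∀ i, ψ (x i) = A⁻¹ * ψ (y i))
    (hy' : ∀ i, ψ (y i) ≠ 0) (hyy : ∀ i j, i ≠ j → ScaleIndep A (ψ (y i)) (ψ (y j))) :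
    partitionDW n A (fun i => φ (x i)) (fun i => φ (y i)) ≠ 0 := by
  intro h
  rw [← polyDW_eq_zero_iff hA n _ _ hx hy] at h
  have e := map_polyDW φ n a b x y
  rw [h1, h2, h, map_eq_zero_iff φ hφ] at e
  have e' := map_polyDW ψ n a b x y
  rw [e, map_zero, h3, h4] at e'
  simp only [hxy] at e'
  rw [eq_comm, polyDW_eq_zero_iff hA n _ _ (fun i => mul_ne_zero (inv_ne_zero hA) (hy' i)) hy'] at e'
  exact partitionDW_diagonal_ne_zero hA hA4 _ hy' hyy e'

/-! ### The field of rational functions -/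

section

variable {k : Type*} [Field k] {N : ℕ}

/-- Since a comes from k, its powers are constants. Evaluation at the point whose i-th coordinate is
1 and whose other coordinates are 0 turns the alleged relation into 1 = 0. -/
theorem scaleIndep_variables {a : k} (i j : Fin N ⊕ Fin N) (hij : i ≠ j) :
    ScaleIndep (algebraMap k (SpectralField k N) a)
      (algebraMap (MvPolynomial (Fin N ⊕ Fin N) k) (SpectralField k N) (MvPolynomial.X i))
      (algebraMap (MvPolynomial (Fin N ⊕ Fin N) k) (SpectralField k N) (MvPolynomial.X j)) := by
  intro e h
  rw [← map_zpow₀, IsScalarTower.algebraMap_apply k (MvPolynomial (Fin N ⊕ Fin N) k)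
    (SpectralField k N), ← map_pow, ← map_pow, ← map_mul,
    (IsFractionRing.injective (MvPolynomial (Fin N ⊕ Fin N) k) (SpectralField k N)).eq_iff] at h
  have := congrArg (MvPolynomial.eval (Pi.single i (1 : k))) h
  simp [Pi.single_eq_of_ne hij.symm] at this

theorem generic_variables (a : k) :
    Generic (algebraMap k (SpectralField k N) a) (xVar k N) (yVar k N) where
  left_ne i := by simp [xVar]
  right_ne i := by simp [yVar]
  left i j hij := scaleIndep_variables _ _ (by simpa using hij)
  right i j hij := scaleIndep_variables _ _ (by simpa using hij)
  cross i j := scaleIndep_variables _ _ (by simp)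

theorem partitionDW_variables_ne_zero {a : k} (ha : a ≠ 0) (ha4 : a ^ 4 ≠ 1) {n : ℕ} {f : Fin n → Fin N}
    (hf : Function.Injective f) :
    partitionDW n (algebraMap k (SpectralField k N) a) (fun i => xVar k N (f i))
      (fun i => yVar k N (f i)) ≠ 0 := by
  have hinj := FaithfulSMul.algebraMap_injective k (SpectralField k N)
  have hg := generic_variables (N := N) a
  let φ : MvPolynomial (Fin N ⊕ Fin N) k →ₐ[k] SpectralField k N :=
    MvPolynomial.aeval (Sum.elim (fun i => (algebraMap k (SpectralField k N) a)⁻¹ * yVar k N i)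
      (yVar k N))
  refine partitionDW_ne_zero_of_specialization
    (algebraMap (MvPolynomial (Fin N ⊕ Fin N) k) (SpectralField k N)) φ.toRingHom
    (IsFractionRing.injective _ _) ?_ ?_ (a := MvPolynomial.C a) (b := MvPolynomial.C a⁻¹)
    (x := fun i => MvPolynomial.X (Sum.inl (f i))) (y := fun i => MvPolynomial.X (Sum.inr (f i)))
    (IsScalarTower.algebraMap_apply k _ _ a).symm ?_ (φ.commutes a) ?_ (fun i => hg.left_ne _)
    (fun i => hg.right_ne _) (fun i => ?_) (fun i => ?_) (fun i j hij => ?_)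
  · rwa [Ne, map_eq_zero_iff _ hinj]
  · rw [← map_pow, ← map_one (algebraMap k (SpectralField k N))]
    exact hinj.ne ha4
  · rw [← map_inv₀]
    exact (IsScalarTower.algebraMap_apply k _ _ a⁻¹).symm
  · rw [← map_inv₀]
    exact φ.commutes a⁻¹
  · have h1 : φ.toRingHom (MvPolynomial.X (Sum.inl (f i))) =
        (algebraMap k (SpectralField k N) a)⁻¹ * yVar k N (f i) := MvPolynomial.aeval_X _ _
    have h2 : φ.toRingHom (MvPolynomial.X (Sum.inr (f i))) = yVar k N (f i) :=
      MvPolynomial.aeval_X _ _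
    rw [h1, h2]
  · have h2 : φ.toRingHom (MvPolynomial.X (Sum.inr (f i))) = yVar k N (f i) :=
      MvPolynomial.aeval_X _ _
    rw [h2]
    exact hg.right_ne _
  · have h2 : ∀ i, φ.toRingHom (MvPolynomial.X (Sum.inr (f i))) = yVar k N (f i) :=
      fun i => MvPolynomial.aeval_X _ _
    rw [h2, h2]
    exact hg.right _ _ (hf.ne hij)

end

/-! ### Conclusion -/

theorem ScaleIndep.mul_add_ne_zero {a p q : F} (h : ScaleIndep a q p) :
    a * p + q ≠ 0 := by
  intro h'
  apply h 2
  rw [eq_neg_of_add_eq_zero_right h']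
  norm_cast
  ring

theorem secondFactorHT_eq {a : F} (ha : a ≠ 0) (ha4 : a ^ 4 ≠ 1) {m : ℕ}
    {x y : Fin m → F} (h : Generic a x y) (hZ : partitionDW m a x y ≠ 0) :
    secondFactorHT m a x y = factorDet a x y := by
  rw [secondFactorHT, partitionHTEven_eq, wallEntry_nestOp_one ha ha4 x y h, mul_div_cancel_left₀ _ hZ]

/-- The prefactor results from `wallEntry_crossedOp_rowOp` by the identity a + a⁻¹ + x/y + y/x = (ax
+ y)(ay + x)/(axy). A zero of ax + y or ay + x would make x² and y² differ by the factor a^{±2},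
which genericity excludes. -/
theorem partitionHTOdd_of_generic {a : F} (ha : a ≠ 0) (ha4 : a ^ 4 ≠ 1) {m : ℕ}
    {x y : Fin (m + 1) → F} (h : Generic a x y) (hZ : partitionDW (m + 1) a x y ≠ 0)
    (hZ' : partitionDW m a (fun i => x i.castSucc) (fun i => y i.castSucc) ≠ 0) :
    partitionHTOdd m a x y =
      a * x (Fin.last m) * y (Fin.last m) /
          (sigma a * (a * x (Fin.last m) + y (Fin.last m)) *
            (a * y (Fin.last m) + x (Fin.last m))) *
        (partitionDW (m + 1) a x y *
            secondFactorHT m a (fun i => x i.castSucc) (fun i => y i.castSucc) +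
          partitionDW m a (fun i => x i.castSucc) (fun i => y i.castSucc) *
            secondFactorHT (m + 1) a x y) := by
  have h' : Generic a (fun i => x i.castSucc) (fun i : Fin m => y i.castSucc) :=
    h.comp (Fin.castSucc_injective m) (Fin.castSucc_injective m)
  have hx : (Fin.snoc (fun i => x i.castSucc) (x (Fin.last m)) : Fin (m + 1) → F) = x :=
    Fin.snoc_init_self x
  have hy : (Fin.snoc (fun i => y i.castSucc) (y (Fin.last m)) : Fin (m + 1) → F) = y :=
    Fin.snoc_init_self y
  have key := wallEntry_crossedOp_rowOp ha ha4 (fun i => x i.castSucc) (x (Fin.last m))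
    (fun i => y i.castSucc) (y (Fin.last m)) (by rwa [hx, hy])
  rw [turnProduct, turnProduct, hx, hy, ← partitionHTOdd_eq, cond_true, cond_false] at key
  rw [secondFactorHT_eq ha ha4 h hZ, secondFactorHT_eq ha ha4 h' hZ', ← key]
  have hu := h.left_ne (Fin.last m)
  have hw := h.right_ne (Fin.last m)
  have h1 := ((h.cross (Fin.last m) (Fin.last m)).symm ha).mul_add_ne_zero
  have h2 := (h.cross (Fin.last m) (Fin.last m)).mul_add_ne_zero
  have hs : sigma a ≠ 0 := sigma_ne_zero ha fun h => ha4 (by rw [pow_mul a 2 2, h, one_pow])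
  rw [div_mul_eq_mul_div, eq_div_iff (mul_ne_zero (mul_ne_zero hs h1) h2)]
  field_simp
  ring

end SquareIce

theorem theorem1 {k : Type*} [Field k] (a₀ : k) (ha : a₀ ≠ 0) (ha4 : a₀ ^ 4 ≠ 1) (m : ℕ)
    (a : SpectralField k (m + 1)) (h_a : a = algebraMap k (SpectralField k (m + 1)) a₀)
    (x y : Fin (m + 1) → SpectralField k (m + 1))
    (hx : x = xVar k (m + 1)) (hy : y = yVar k (m + 1))
    (x' y' : Fin m → SpectralField k (m + 1))
    (hx' : x' = fun i => x i.castSucc) (hy' : y' = fun i => y i.castSucc) :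
    partitionDW m a x' y' ≠ 0 ∧
    partitionDW (m + 1) a x y ≠ 0 ∧
    partitionHTOdd m a x y =
      a * x (Fin.last m) * y (Fin.last m) /
          (sigma a * (a * x (Fin.last m) + y (Fin.last m)) *
            (a * y (Fin.last m) + x (Fin.last m))) *
        (partitionDW (m + 1) a x y * secondFactorHT m a x' y' +
          partitionDW m a x' y' * secondFactorHT (m + 1) a x y) := by
  subst hx' hy' hx hy h_a
  have hZ' := partitionDW_variables_ne_zero ha ha4 (Fin.castSucc_injective m)
  have hZ := partitionDW_variables_ne_zero ha ha4 (Function.injective_id (α := Fin (m + 1)))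
  have hinj := FaithfulSMul.algebraMap_injective k (SpectralField k (m + 1))
  refine ⟨hZ', hZ, partitionHTOdd_of_generic ?_ ?_ (generic_variables a₀) hZ hZ'⟩
  · rwa [Ne, map_eq_zero_iff _ hinj]
  · rw [← map_pow, ← map_one (algebraMap k (SpectralField k (m + 1)))]
    exact hinj.ne ha4
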